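/- **Setting.** A weighted Holant instance $\Omega$ consists of a finite graph $G=(V,E)$ (parallel edges and loops are allowed, a loop counts twice in the degree), for every vertex $v$ of degree $d_v$ a symmetric function $[f_0,\dots,f_{d_v}]$ with values in the non-negative reals ($f_j$ is the value $F_v$ takes on inputs of Hamming weight $j$), and for every edge $e$ a real weight $\lambda_e$. Its partition function is $$Z(\Omega)=\sum_{\sigma:E\to\{0,1\}}\ \prod_{e\in E}\lambda_e^{\sigma(e)}\prod_{v\in V}F_v(\sigma|_{E(v)}),$$ where $E(v)$ denotes the edges incident with $v$. For $c,p,q\in\mathbb R$ let $\mathcal F_c^{p,q}$ be the set of all symmetric functions $[f_0,\dots,f_d]$, of any arity $d\ge 0$, with non-negative values such that $f_{i+2}=cf_{i+1}+f_i$ for $0\le i\le d-2$ and $p f_i\le f_{i+1}\le q f_i$ for $0\le i\le d-1$. Let $\Lambda_{\lambda,+\infty}=[\lambda,+\infty)$. The problem $\mathrm{Holant}(\mathcal F,\Lambda)$ asks for $Z(\Omega)$, given an instance $\Omega$ all of whose vertex functions lie in $\mathcal F$ and all of whose edge weights lie in $\Lambda$. A fully polynomial-time approximation scheme (FPTAS)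 for $\mathrm{Holant}(\mathcal F,\Lambda)$ is a deterministic algorithm that, given an instance $\Omega$ and $\varepsilon>0$, outputs a number $Z'$ with $(1-\varepsilon)Z(\Omega)<Z'<(1+\varepsilon)Z(\Omega)$ (and $Z'=0$ if $Z(\Omega)=0$) and runs in time polynomial in $|V|+|E|$ and $1/\varepsilon$. Here the algorithm is one program with rational constants that works with exact real numbers, each field operation or comparison being one step; moreover, if all numbers in the input are rational, the bit cost of the same program is polynomial in the bit length of the input and $1/\varepsilon$. **Theorem.** Let $\lambda>0$ and $c\ge 2.57$ be real numbers. Then there is an FPTAS for $\mathrm{Holant}\bigl(\mathcal F_c^{c/2,\,c+2/c},\ \Lambda_{\lambda,+\infty}\bigr)$. -/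

import Mathlib

/-!
Weighted Holant problems with symmetric signatures, Fibonacci signatures, a programming language
with an explicit cost semantics, and fully polynomial-time approximation schemes.
-/

/-! ### Weighted Holant instances -/

/-- The number of ends of an edge with end points `p` that lie at the vertex `v`
(`2` for a loop at `v`). -/
def endsAt {n : ℕ} (p : Fin n × Fin n) (v : Fin n) : ℕ :=
  (if p.1 = v then 1 else 0) + (if p.2 = v then 1 else 0)

/-- A weighted Holant instance with symmetric vertex functions. The graph has vertex set `Fin n` and
edges indexed by `Fin m`; parallel edges and loops are allowed. The function at `v` is given by
`sig v = [f_0, …, f_d]`, where `d` is the degree of `v` and `f_j` is the value on inputs of Hamming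
weight `j`. Edge weights are normalized: the weight of the edge `e` is `1` if `e` is not chosen and
`weight e` if it is. -/
structure HolantInstance where
  n : ℕ
  m : ℕ
  ends : Fin m → Fin n × Fin n
  weight : Fin m → ℝ
  sig : Fin n → List ℝ
  sig_length : ∀ v, (sig v).length = (∑ e, endsAt (ends e) v) + 1

namespace HolantInstance

/-- The Hamming weight of the restriction of `σ` to the edges incident with `v`. -/
def load (Ω : HolantInstance) (σ : Fin Ω.m → Bool) (v : Fin Ω.n) : ℕ :=
  ∑ e, if σ e then endsAt (Ω.ends e) v else 0

theorem load_lt_length (Ω : HolantInstance) (σ : Fin Ω.m → Bool) (v : Fin Ω.n) :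
    Ω.load σ v < (Ω.sig v).length := by
  rw [Ω.sig_length v]
  refine Nat.lt_succ_of_le (Finset.sum_le_sum fun e _ => ?_)
  split <;> simp

/-- The weight of a configuration. -/
noncomputable def configWeight (Ω : HolantInstance) (σ : Fin Ω.m → Bool) : ℝ :=
  (∏ e, if σ e then Ω.weight e else 1) *
    ∏ v, (Ω.sig v)[Ω.load σ v]'(Ω.load_lt_length σ v)

/-- The partition function. -/
noncomputable def Z (Ω : HolantInstance) : ℝ := ∑ σ : Fin Ω.m → Bool, Ω.configWeight σ

/-- `Ω` is an instance of the problem `Holant(F, Λ)`. -/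
def IsInstanceOf (Ω : HolantInstance) (F : Set (List ℝ)) (Λ : Set ℝ) : Prop :=
  (∀ v, Ω.sig v ∈ F) ∧ ∀ e, Ω.weight e ∈ Λ

end HolantInstance

/-- The family of nonnegative symmetric functions `[f_0, …, f_d]` (of any arity `d`) with
`f_{i+2} = c f_{i+1} + f_i` for `0 ≤ i ≤ d - 2` and
`p f_i ≤ f_{i+1} ≤ q f_i` for `0 ≤ i ≤ d - 1`. -/
def fibonacciFamily (c p q : ℝ) : Set (List ℝ) :=
  {f | (∀ x ∈ f, 0 ≤ x) ∧
    (∀ (i : ℕ) (h : i + 2 < f.length), f[i + 2] = c * f[i + 1] + f[i]) ∧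
    ∀ (i : ℕ) (h : i + 1 < f.length), p * f[i] ≤ f[i + 1] ∧ f[i + 1] ≤ q * f[i]}

/-! ### Programs and their running time

A first-order recursive language whose data are binary trees with real numbers at the leaves.
The numerical operations are the exact field operations and comparison (no rounding), and the only
numerical constants in a program are rational. -/

namespace RealProg

/-- Data: real numbers, the empty list, and pairs. -/
inductive Val where
  | num (x : ℝ) : Val
  | nil : Val
  | cons (a b : Val) : Val

inductive Op where
  | add | sub | mul | div

noncomputable def Op.apply : Op → ℝ → ℝ → ℝ
  | .add, x, y => x + y
  | .sub, x, y => x - y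
  | .mul, x, y => x * y
  | .div, x, y => x / y

/-- Terms. Variables are de Bruijn indices; `bind a b` evaluates `a` and binds its value in `b`;
`ifLe a b s t` is `s` if `a ≤ b` and `t` otherwise; `split a s t` is `s` if `a` is the empty list,
and `t` with the two components bound (the first one to index `0`) if `a` is a pair; `call f a` calls
the `f`-th function of the program with argument `a`. -/
inductive Term where
  | var (i : ℕ) : Term
  | const (q : ℚ) : Term
  | nil : Term
  | cons (a b : Term) : Term
  | arith (o : Op) (a b : Term) : Term
  | bind (a b : Term) : Term
  | ifLe (a b s t : Term) : Term
  | split (a s t : Term) : Term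
  | call (f : ℕ) (a : Term) : Term

/-- A program: the bodies of its (mutually recursive, unary) functions, and its main term, whose
variable `0` is the input. -/
structure Program where
  funs : List Term
  main : Term

/-- `Eval w fs env e v t`: in the environment `env`, the term `e` evaluates to `v` at cost `t`.
Every elementary step costs `1`; an arithmetic operation or a comparison costs in addition the
weights `w` of the numbers involved. Division by zero, comparing or calculating with
something that is not a number, splitting a number, and an undefined variable or function have no
value. -/
inductive Eval (w : ℝ → ℕ) (fs : List Term) : List Val → Term → Val → ℕ → Prop where
  | var {env : List Val} {i : ℕ} {v : Val} (h : env[i]? = some v) :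
      Eval w fs env (.var i) v 1
  | const {env : List Val} (q : ℚ) : Eval w fs env (.const q) (.num q) 1
  | nil {env : List Val} : Eval w fs env .nil .nil 1
  | cons {env : List Val} {a b : Term} {u v : Val} {s t : ℕ}
      (ha : Eval w fs env a u s) (hb : Eval w fs env b v t) :
      Eval w fs env (.cons a b) (.cons u v) (s + t + 1)
  | arith {env : List Val} {o : Op} {a b : Term} {x y : ℝ} {s t : ℕ}
      (ha : Eval w fs env a (.num x) s) (hb : Eval w fs env b (.num y) t)
      (hdiv : o = Op.div → y ≠ 0) :
      Eval w fs env (.arith o a b) (.num (o.apply x y))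
        (s + t + 1 + (w x + w y + w (o.apply x y)))
  | bind {env : List Val} {a b : Term} {u v : Val} {s t : ℕ}
      (ha : Eval w fs env a u s) (hb : Eval w fs (u :: env) b v t) :
      Eval w fs env (.bind a b) v (s + t + 1)
  | ifLe_true {env : List Val} {a b e₁ e₂ : Term} {x y : ℝ} {v : Val} {r s t : ℕ}
      (ha : Eval w fs env a (.num x) r) (hb : Eval w fs env b (.num y) s) (hxy : x ≤ y)
      (he : Eval w fs env e₁ v t) :
      Eval w fs env (.ifLe a b e₁ e₂) v (r + s + t + 1 + (w x + w y))
  | ifLe_false {env : List Val} {a b e₁ e₂ : Term} {x y : ℝ} {v : Val} {r s t : ℕ}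
      (ha : Eval w fs env a (.num x) r) (hb : Eval w fs env b (.num y) s) (hxy : ¬ x ≤ y)
      (he : Eval w fs env e₂ v t) :
      Eval w fs env (.ifLe a b e₁ e₂) v (r + s + t + 1 + (w x + w y))
  | split_nil {env : List Val} {a e₁ e₂ : Term} {v : Val} {s t : ℕ}
      (ha : Eval w fs env a .nil s) (he : Eval w fs env e₁ v t) :
      Eval w fs env (.split a e₁ e₂) v (s + t + 1)
  | split_cons {env : List Val} {a e₁ e₂ : Term} {p q v : Val} {s t : ℕ}
      (ha : Eval w fs env a (.cons p q) s) (he : Eval w fs (p :: q :: env) e₂ v t) :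
      Eval w fs env (.split a e₁ e₂) v (s + t + 1)
  | call {env : List Val} {f : ℕ} {a body : Term} {u v : Val} {s t : ℕ}
      (hf : fs[f]? = some body) (ha : Eval w fs env a u s) (hb : Eval w fs [u] body v t) :
      Eval w fs env (.call f a) v (s + t + 1)

/-- The program `P` halts on `input` with result `v` and cost `t`. -/
def Program.Run (P : Program) (w : ℝ → ℕ) (input v : Val) (t : ℕ) : Prop :=
  Eval w P.funs [input] P.main v t

/-- Evaluation is deterministic: value and cost are determined, and the value does not depend on the
cost measure. -/
theorem Eval.value_unique {w w' : ℝ → ℕ} {fs : List Term} {env : List Val} {e : Term} {v v' : Val}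
    {t t' : ℕ} (h : Eval w fs env e v t) (h' : Eval w' fs env e v' t') :
    v = v' ∧ (w = w' → t = t') := by
  induction h generalizing v' t' <;> cases h' <;> grind

/-- The list `[x_0, …, x_k]` as the tree `(x_0 . (x_1 . ( … . nil)))`. -/
def Val.ofList : List Val → Val
  | [] => .nil
  | a :: l => .cons a (Val.ofList l)

end RealProg

open RealProg in
/-- The input of an approximation scheme: `ε`, the list of the vertex functions (each one the list of
its values), and the list of the edges `((u . v) . weight)`. -/
noncomputable def HolantInstance.encode (Ω : HolantInstance) (ε : ℝ) : Val :=
  .cons (.num ε) (.cons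
    (.ofList (List.ofFn fun v => .ofList ((Ω.sig v).map .num)))
    (.ofList (List.ofFn fun e =>
      .cons (.cons (.num ((Ω.ends e).1 : ℕ)) (.num ((Ω.ends e).2 : ℕ))) (.num (Ω.weight e)))))

/-! ### Cost measures and input sizes -/

/-- Unit cost: every operation on real numbers is one step. -/
def unitCost : ℝ → ℕ := fun _ => 0

/-- `x` is a rational number. -/
def IsRat (x : ℝ) : Prop := ∃ q : ℚ, (q : ℝ) = x

open Classical in
/-- The bit length of numerator and denominator of a rational number (`0` for an irrational one, where
it is not used). -/
noncomputable def bitLength (x : ℝ) : ℕ :=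
  if h : IsRat x then Nat.size h.choose.num.natAbs + Nat.size h.choose.den else 0

namespace HolantInstance

/-- The number of vertices and edges. -/
def size (Ω : HolantInstance) : ℕ := Ω.n + Ω.m

/-- All numbers in the instance are rational. -/
def IsRational (Ω : HolantInstance) : Prop :=
  (∀ v, ∀ x ∈ Ω.sig v, IsRat x) ∧ ∀ e, IsRat (Ω.weight e)

/-- The number of vertices and edges plus the total bit length of the numbers. -/
noncomputable def bitSize (Ω : HolantInstance) : ℕ :=
  Ω.size + (∑ v, ((Ω.sig v).map bitLength).sum) + ∑ e, bitLength (Ω.weight e)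

end HolantInstance

/-! ### Approximation schemes -/

/-- `z` approximates `Z` with relative error less than `ε`; if `Z = 0`, it is exact. -/
def ApproximatesWithin (ε Z z : ℝ) : Prop :=
  (Z ≠ 0 → (1 - ε) * Z < z ∧ z < (1 + ε) * Z) ∧ (Z = 0 → z = 0)

open RealProg in
/-- `Holant(F, Λ)` has a (deterministic) fully polynomial-time approximation scheme: one program
computes, for all instances and all `ε > 0`, an approximation of the partition function within `ε`,

* in a number of steps polynomial in the number of vertices and edges and in `1/ε`, where one
  operation on real numbers is one step;
* and, if all the numbers in the input are rational, also in bit cost polynomial in the bit size of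
  the input and in `1/ε`. -/
def HasFPTAS (F : Set (List ℝ)) (Λ : Set ℝ) : Prop :=
  ∃ (P : Program) (C k : ℕ), ∀ Ω : HolantInstance, Ω.IsInstanceOf F Λ → ∀ ε : ℝ, 0 < ε →
    ∃ z : ℝ, ApproximatesWithin ε Ω.Z z ∧
      (∃ t : ℕ, P.Run unitCost (Ω.encode ε) (.num z) t ∧
        (t : ℝ) ≤ C * (Ω.size + 1 / ε + 1) ^ k) ∧
      (Ω.IsRational → IsRat ε →
        ∃ t : ℕ, P.Run bitLength (Ω.encode ε) (.num z) t ∧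
          (t : ℝ) ≤ C * (Ω.bitSize + bitLength ε + 1 / ε + 1) ^ k)

/-! ### Contraction of the recursion for edge marginals -/

/-! The scheme rests on correlation decay. Let the marginal at v be the quotient of the partition
functions with one extra end at v pinned to 1 and to 0. The Fibonacci recurrence is linear, so the
whole graph seen from a dangling end at v obeys it too (`partition_shift_shift`), and the quotient
stays in [c/2, c + 2/c] (`partition_shift_bounds`). Removing an edge vu of weight w therefore
expresses the marginal at v through three marginals of the smaller graph: A at v, β at u, and B at v
with an extra end at u pinned to 1. It equals (A + wβ(cB + 1)) / (1 + wβB)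
(`marginal_of_extract_eq_some`). The branching number is three whatever the degrees are.

After division by c, this map is a contraction in the coordinate Φ(r) = log((r - 1/4)/(2 - r)), with
Φ' = (7/4)/ζ and ζ(r) = (r - 1/4)(2 - r). The inequality needed is Σ |∂F/∂x_i| ζ(x_i) ≤ rate · ζ(F)
(`gradient_bound`); integration along a path gives `potential_step_contract`. The rate is below 1
because the edge weights are bounded away from 0. Cutting the recursion at depth l then determines
each marginal up to a factor exp(11 · rate^l) (`near_marginal_ratio`).

Adding one edge multiplies the partition function by 1 + w · (product of two marginals), so Z
telescopes into approximable factors (`near_partition_approx`). Depth O(log(m/ε)) suffices. Both the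
running time and the bit length of the numbers grow by at most a constant factor per level, hence
stay polynomial (`costs_ratio`, `depth_cost_le`). An abstract `CostModel` treats unit cost and bit
cost at once.

The real number c cannot occur in a program. It is recovered as (f_2 - f_0)/f_1 at a vertex where it
is needed; enough values are always left there (`Represents`). The only program constant depending
on λ and c is a rational β between 1 and 1/rate, which fixes the depth. If some f_0 vanishes, then Z
= 0, and the program tests this first. -/

namespace FibHolant

/-- The density of the potential function. -/
noncomputable def zeta (r : ℝ) : ℝ := (r - 1 / 4) * (2 - r)

/-- For r > 0 the quotient ζ(r)/r = 9/4 - r - 1/(2r) is at most 9/4 - √2 < 0.84, attained at r =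
1/√2. This trades k ζ(β) for a multiple of ν = kβ. -/
theorem zeta_le_mul (r : ℝ) : zeta r ≤ 0.84 * r := by
  unfold zeta
  nlinarith [sq_nonneg (r - 0.705)]

theorem zeta_le_one (r : ℝ) : zeta r ≤ 1 := by
  unfold zeta
  nlinarith [sq_nonneg (r - 9 / 8)]

theorem zeta_pos {r : ℝ} (h₁ : 1 / 4 < r) (h₂ : r < 2) : 0 < zeta r :=
  mul_pos (by linarith) (by linarith)

/-- The coefficient of `ν` in `(N - D / 4) * (2 * D - N)`. -/
noncomputable def coeffOne (η a b : ℝ) : ℝ := (a - 1 / 4) * (b - η) + (2 - a) * (3 / 4 * b + η)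

/-- The coefficient of `ν ^ 2` in `(N - D / 4) * (2 * D - N)`. -/
noncomputable def coeffTwo (η b : ℝ) : ℝ := (3 / 4 * b + η) * (b - η)

/-- Together with ν ≥ k₀/2 this yields the constant 0.15 in `rate`. -/
theorem coeffOne_ge {η a b : ℝ} (hη : 0 < η) (hη' : η ≤ 0.1515) (ha : 1 / 2 ≤ a)
    (ha' : a ≤ 1 + 2 * η) (hb : 1 / 2 ≤ b) : 0.3 ≤ coeffOne η a b := by
  unfold coeffOne
  nlinarith [mul_nonneg (sub_nonneg.2 ha) (sub_nonneg.2 hb),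
    mul_nonneg (sub_nonneg.2 ha') (sub_nonneg.2 hb)]

/-- First order in ν of the gradient inequality: the three summands come from the derivatives in a,
b and β, and 0.9 is the gain. -/
theorem coeffOne_bound {η a b : ℝ} (hη : 0 < η) (hη' : η ≤ 0.1515) (ha : 1 / 2 ≤ a)
    (ha' : a ≤ 1 + 2 * η) (hb : 1 / 2 ≤ b) (hb' : b ≤ 1 + 2 * η) :
    zeta a * b + |1 - a| * zeta b + |b + η - a * b| * 0.84 ≤ 0.9 * coeffOne η a b := by
  unfold zeta coeffOne
  rcases le_total a 1 with h1 | h1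
  · rw [abs_of_nonneg (by linarith), abs_of_nonneg (by nlinarith)]
    nlinarith [mul_nonneg (sub_nonneg.2 h1) (sq_nonneg (b - 0.7)),
      mul_nonneg (sub_nonneg.2 ha) (sub_nonneg.2 hb),
      mul_nonneg (mul_nonneg (sub_nonneg.2 ha) (sub_nonneg.2 ha)) (sub_nonneg.2 hb),
      mul_nonneg (sub_nonneg.2 ha) (sub_nonneg.2 hη'), mul_nonneg (sub_nonneg.2 h1) hη.le,
      mul_nonneg (sub_nonneg.2 h1) (sub_nonneg.2 ha)]
  · obtain ⟨h, rfl⟩ : ∃ h, a = 1 + h := ⟨a - 1, by ring⟩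
    have h0 : 0 ≤ h := by linarith
    have h2 : h ≤ 0.303 := by linarith
    rw [abs_of_nonpos (by linarith)]
    -- These are the terms linear in h and free of η, outside the last absolute value; 2.275 = 9/4 +
    -- 1/4 - 0.9/4. The concave quadratic in b is replaced by its tangent at b = 1/2.
    have hq : h * (2.275 * b - b ^ 2 - 0.5) ≤ 0.303 * (1.275 * b - 0.25) :=
      mul_le_mul h2 (by nlinarith [sq_nonneg (b - 0.5)]) (by nlinarith) (by norm_num)
    rcases le_total 0 (b + η - (1 + h) * b) with h3 | h3
    · rw [abs_of_nonneg h3]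
      nlinarith [mul_nonneg h0 (sub_nonneg.2 hb), mul_nonneg h0 (sub_nonneg.2 hη'),
        mul_nonneg (mul_nonneg h0 h0) (sub_nonneg.2 hb)]
    · rw [abs_of_nonpos h3]
      nlinarith [mul_nonneg h0 (sub_nonneg.2 hb), mul_nonneg h0 (sub_nonneg.2 hη'),
        mul_nonneg (mul_nonneg h0 h0) (sub_nonneg.2 hb), mul_nonneg (sub_nonneg.2 h2) (sub_nonneg.2 hb)]

theorem coeffTwo_bound {η b : ℝ} (hη : 0 < η) (hη' : η ≤ 0.1515)
    (hb : 1 / 2 ≤ b) (hb' : b ≤ 1 + 2 * η) :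
    η * zeta b ≤ 0.9 * coeffTwo η b := by
  unfold zeta coeffTwo
  nlinarith [mul_nonneg (sub_nonneg.2 hb) (sub_nonneg.2 hb'), mul_nonneg hη.le (sub_nonneg.2 hb), mul_nonneg hη.le (sub_nonneg.2 hη')]

/-- The recursion, in units of `c`: `a` and `b` are the marginals at the vertex with the edge removed
and the other end of the edge pinned to `0` and `1`, and `β` is the marginal at that other end. -/
noncomputable def step (η k a b β : ℝ) : ℝ := (a + k * β * (b + η)) / (1 + k * β * b)

/-- The interval of all marginals, in units of `c`. -/
def box (η : ℝ) : Set ℝ := Set.Icc (1 / 2) (1 + 2 * η)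

/-- The rate of contraction if all edge weights are at least `k / c ^ 2`. -/
noncomputable def rate (k : ℝ) : ℝ := 1 - 0.1 * (0.15 * k / (1 + 0.15 * k))

theorem rate_pos {k : ℝ} (hk : 0 < k) : 0 < rate k := by
  have : 0.15 * k / (1 + 0.15 * k) ≤ 1 := by
    rw [div_le_one (by positivity)]; linarith
  unfold rate; linarith

theorem rate_lt_one {k : ℝ} (hk : 0 < k) : rate k < 1 := by
  have : 0 < 0.15 * k / (1 + 0.15 * k) := by positivity
  unfold rate; linarith

/-- This is Σ |∂F/∂x_i| ζ(x_i) ≤ rate · ζ(F) for F = `step`, multiplied by the square of the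
denominator of F. With ν = kβ both sides are compared with polynomials of degree 2 in ν having the
same constant term ζ(a); the coefficients of ν and ν² gain the factor 0.9. -/
theorem gradient_bound {η k₀ k a b β : ℝ} (hη : 0 < η) (hη' : η ≤ 0.1515) (hk₀ : 0 < k₀)
    (hk : k₀ ≤ k) (ha : a ∈ box η) (hb : b ∈ box η) (hβ : β ∈ box η) :
    zeta a * (1 + k * β * b) + k * β * |1 - a - k * β * η| * zeta b +
      k * |b + η - a * b| * zeta β ≤
    rate k₀ * ((a + k * β * (b + η) - (1 + k * β * b) / 4) *
      (2 * (1 + k * β * b) - (a + k * β * (b + η)))) := by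
  obtain ⟨ha, ha'⟩ := ha
  obtain ⟨hb, hb'⟩ := hb
  obtain ⟨hβ, hβ'⟩ := hβ
  have hk0 : 0 < k := hk₀.trans_le hk
  set ν := k * β with hν
  have hν0 : k₀ / 2 ≤ ν := by nlinarith
  have hνp : 0 < ν := by linarith
  have hone := coeffOne_bound hη hη' ha ha' hb hb'
  have htwo := coeffTwo_bound hη hη' hb hb'
  have hge := coeffOne_ge hη hη' ha ha' hb
  have hza : 0 < zeta a := zeta_pos (by linarith) (by linarith)
  have hzb : 0 < zeta b := zeta_pos (by linarith) (by linarith)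
  have htwo0 : 0 ≤ coeffTwo η b := by
    have : 0 ≤ η * zeta b := by positivity
    linarith
  have hexp : (a + ν * (b + η) - (1 + ν * b) / 4) * (2 * (1 + ν * b) - (a + ν * (b + η))) =
      zeta a + ν * coeffOne η a b + ν ^ 2 * coeffTwo η b := by
    unfold zeta coeffOne coeffTwo; ring
  have h1 : k * |b + η - a * b| * zeta β ≤ ν * (|b + η - a * b| * 0.84) := by
    have := mul_le_mul_of_nonneg_left (zeta_le_mul β)
      (mul_nonneg hk0.le (abs_nonneg (b + η - a * b)))
    calc _ ≤ _ := this
      _ = _ := by rw [hν]; ring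
  have h2 : ν * |1 - a - ν * η| * zeta b ≤ ν * (|1 - a| * zeta b) + ν ^ 2 * (η * zeta b) := by
    have h3 : |1 - a - ν * η| ≤ |1 - a| + ν * η := by
      have := abs_sub (1 - a) (ν * η)
      rwa [abs_of_pos (mul_pos hνp hη)] at this
    have := mul_le_mul_of_nonneg_right (mul_le_mul_of_nonneg_left h3 hνp.le) hzb.le
    calc _ ≤ _ := this
      _ = _ := by ring
  have h4 := mul_le_mul_of_nonneg_left hone hνp.le
  have h5 := mul_le_mul_of_nonneg_left htwo (sq_nonneg ν)
  set S := ν * coeffOne η a b + ν ^ 2 * coeffTwo η b with hS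
  have hS0 : 0.15 * k₀ ≤ S := by
    have : 0 ≤ ν ^ 2 * coeffTwo η b := by positivity
    nlinarith
  -- The constant term gains nothing, so S must be a definite share of the total; S ≥ 0.15 k₀ and
  -- ζ(a) ≤ 1 ensure it.
  have hrate : zeta a + 0.9 * S ≤ rate k₀ * (zeta a + S) := by
    have h6 : 0.15 * k₀ / (1 + 0.15 * k₀) * (zeta a + S) ≤ S := by
      rw [div_mul_eq_mul_div, div_le_iff₀ (by positivity)]
      nlinarith [zeta_le_one a]
    unfold rate
    nlinarith
  rw [hexp]
  calc _ ≤ zeta a + 0.9 * S := by rw [hS]; linarith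
    _ ≤ rate k₀ * (zeta a + S) := hrate
    _ = _ := by rw [hS]; ring

/-- The value is a weighted mean of a and (b + η)/b, and b ≥ 1/2 gives 1 ≤ (b + η)/b ≤ 1 + 2η. -/
theorem step_mem_box {η k a b β : ℝ} (hη : 0 < η) (hk : 0 < k) (ha : a ∈ box η)
    (hb : b ∈ box η) (hβ : β ∈ box η) : step η k a b β ∈ box η := by
  obtain ⟨ha, ha'⟩ := ha
  obtain ⟨hb, hb'⟩ := hb
  obtain ⟨hβ, hβ'⟩ := hβ
  have hν : 0 < k * β := by nlinarith
  have hD : 0 < 1 + k * β * b := by nlinarith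
  constructor
  · rw [step, le_div_iff₀ hD]
    nlinarith
  · rw [step, div_le_iff₀ hD]
    nlinarith [mul_nonneg hν.le (mul_nonneg hη.le (sub_nonneg.2 hb))]

/-! ### The potential coordinate and contraction in it -/

/-- The potential function. -/
noncomputable def potential (r : ℝ) : ℝ := Real.log ((r - 1 / 4) / (2 - r))

/-- The inverse of the potential function. -/
noncomputable def fromPotential (x : ℝ) : ℝ := (1 / 4 + 2 * Real.exp x) / (1 + Real.exp x)

theorem fromPotential_potential {r : ℝ} (h₁ : 1 / 4 < r) (h₂ : r < 2) :
    fromPotential (potential r) = r := by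
  have h3 : 0 < 2 - r := by linarith
  have h4 : 0 < r - 1 / 4 := by linarith
  rw [fromPotential, potential, Real.exp_log (by positivity)]
  have : 1 + (r - 1 / 4) / (2 - r) ≠ 0 := by positivity
  field_simp
  ring

theorem fromPotential_mono : Monotone fromPotential := by
  intro x y hxy
  have := Real.exp_le_exp.2 hxy
  have hx := Real.exp_pos x
  have hy := Real.exp_pos y
  rw [fromPotential, fromPotential, div_le_div_iff₀ (by positivity) (by positivity)]
  nlinarith

theorem hasDerivAt_fromPotential (x : ℝ) :
    HasDerivAt fromPotential (4 / 7 * zeta (fromPotential x)) x := by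
  have hx := Real.exp_pos x
  have h := (((Real.hasDerivAt_exp x).const_mul 2).const_add (1 / 4)).div
    ((Real.hasDerivAt_exp x).const_add 1) (by positivity)
  refine h.congr_deriv ?_
  unfold zeta fromPotential
  field_simp
  ring

theorem hasDerivAt_potential {r : ℝ} (h₁ : 1 / 4 < r) (h₂ : r < 2) :
    HasDerivAt potential (7 / 4 / zeta r) r := by
  have h3 : 2 - r ≠ 0 := by linarith
  have h4 : r - 1 / 4 ≠ 0 := by linarith
  have h := (((hasDerivAt_id r).sub_const (1 / 4)).div ((hasDerivAt_id r).const_sub 2) h3).log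
    (div_ne_zero h4 h3)
  refine h.congr_deriv ?_
  unfold zeta
  simp only [id, Pi.div_apply]
  field_simp
  ring

/-- The recursion contracts distances with respect to the potential. -/
theorem potential_step_contract {η k₀ k δ a b β a' b' β' : ℝ} (hη : 0 < η) (hη' : η ≤ 0.1515)
    (hk₀ : 0 < k₀) (hk : k₀ ≤ k) (ha : a ∈ box η) (hb : b ∈ box η) (hβ : β ∈ box η)
    (ha' : a' ∈ box η) (hb' : b' ∈ box η) (hβ' : β' ∈ box η)
    (hda : |potential a' - potential a| ≤ δ) (hdb : |potential b' - potential b| ≤ δ)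
    (hdβ : |potential β' - potential β| ≤ δ) :
    |potential (step η k a' b' β') - potential (step η k a b β)| ≤ rate k₀ * δ := by
  have hlt : ∀ r ∈ box η, 1 / 4 < r ∧ r < 2 := fun r hr => ⟨by linarith [hr.1], by linarith [hr.2]⟩
  have hδ : 0 ≤ δ := (abs_nonneg _).trans hda
  have hk0 : 0 < k := hk₀.trans_le hk
  -- Each argument moves along a straight segment in the potential coordinate, so its speed there is
  -- constant and at most δ.
  let path : ℝ → ℝ → ℝ → ℝ := fun r r' s =>
    fromPotential (potential r + s * (potential r' - potential r))
  have path_mem : ∀ r ∈ box η, ∀ r' ∈ box η, ∀ s ∈ Set.Icc (0 : ℝ) 1, path r r' s ∈ box η := by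
    intro r hr r' hr' s hs
    have e := fromPotential_potential (hlt r hr).1 (hlt r hr).2
    have e' := fromPotential_potential (hlt r' hr').1 (hlt r' hr').2
    rcases le_total (potential r) (potential r') with h | h
    · have h1 : fromPotential (potential r) ≤ path r r' s :=
        fromPotential_mono (by nlinarith [hs.1])
      have h2 : path r r' s ≤ fromPotential (potential r') :=
        fromPotential_mono (by nlinarith [hs.2])
      exact ⟨by linarith [hr.1], by linarith [hr'.2]⟩
    · have h1 : fromPotential (potential r') ≤ path r r' s :=
        fromPotential_mono (by nlinarith [hs.2])
      have h2 : path r r' s ≤ fromPotential (potential r) :=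
        fromPotential_mono (by nlinarith [hs.1])
      exact ⟨by linarith [hr'.1], by linarith [hr.2]⟩
  have path_deriv : ∀ r r' s, HasDerivAt (path r r')
      (4 / 7 * zeta (path r r' s) * (potential r' - potential r)) s := by
    intro r r' s
    have h : HasDerivAt (fun s => potential r + s * (potential r' - potential r))
        (potential r' - potential r) s := by
      simpa using ((hasDerivAt_id s).mul_const (potential r' - potential r)).const_add (potential r)
    exact (hasDerivAt_fromPotential _).comp s h
  have path_zero : ∀ r ∈ box η, ∀ r', path r r' 0 = r := fun r hr r' => by
    simp only [path, zero_mul, add_zero]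
    exact fromPotential_potential (hlt r hr).1 (hlt r hr).2
  have path_one : ∀ r, ∀ r' ∈ box η, path r r' 1 = r' := fun r r' hr => by
    simp only [path, one_mul, add_sub_cancel]
    exact fromPotential_potential (hlt r' hr).1 (hlt r' hr).2
  let G : ℝ → ℝ := fun s => potential (step η k (path a a' s) (path b b' s) (path β β' s))
  have key : ∀ s ∈ Set.Icc (0 : ℝ) 1, ∃ g, HasDerivAt G g s ∧ |g| ≤ rate k₀ * δ := by
    intro s hs
    have mA := path_mem a ha a' ha' s hs
    have mB := path_mem b hb b' hb' s hs
    have mC := path_mem β hβ β' hβ' s hs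
    have dA := path_deriv a a' s
    have dB := path_deriv b b' s
    have dC := path_deriv β β' s
    have mF := step_mem_box hη hk0 mA mB mC
    have hgrad := gradient_bound hη hη' hk₀ hk mA mB mC
    have hzA := zeta_pos (hlt _ mA).1 (hlt _ mA).2
    have hzB := zeta_pos (hlt _ mB).1 (hlt _ mB).2
    have hzC := zeta_pos (hlt _ mC).1 (hlt _ mC).2
    have hzF := zeta_pos (hlt _ mF).1 (hlt _ mF).2
    have hCpos : 0 < path β β' s := by linarith [mC.1]
    have hBpos : 0 < path b b' s := by linarith [mB.1]
    have hD : 0 < 1 + k * path β β' s * path b b' s := by positivity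
    have dF := (dA.add ((dC.const_mul k).mul (dB.add_const η))).div
      (((dC.const_mul k).mul dB).const_add 1) hD.ne'
    have dG := (hasDerivAt_potential (hlt _ mF).1 (hlt _ mF).2).comp s dF
    refine ⟨_, dG, ?_⟩
    simp only [Pi.mul_apply, Pi.add_apply]
    generalize path a a' s = A at *
    generalize path b b' s = B at *
    generalize path β β' s = C at *
    set x := potential a' - potential a
    set y := potential b' - potential b
    set z := potential β' - potential β
    have hzF' : zeta (step η k A B C) * (1 + k * C * B) ^ 2 =
        (A + k * C * (B + η) - (1 + k * C * B) / 4) *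
          (2 * (1 + k * C * B) - (A + k * C * (B + η))) := by
      unfold zeta step
      field_simp
    rw [← hzF'] at hgrad
    have hnum : |zeta A * (1 + k * C * B) * x + k * C * (1 - A - k * C * η) * zeta B * y +
        k * (B + η - A * B) * zeta C * z| ≤ rate k₀ * (zeta (step η k A B C) *
          (1 + k * C * B) ^ 2) * δ := by
      refine le_trans ?_ (mul_le_mul_of_nonneg_right hgrad hδ)
      refine (abs_add_three _ _ _).trans ?_
      simp only [abs_mul, abs_of_pos hzA, abs_of_pos hzB, abs_of_pos hzC, abs_of_pos hD,
        abs_of_pos hk0, abs_of_pos hCpos, add_mul]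
      gcongr
    -- The 7/4 of the potential cancels the 4/7 of its inverse, which leaves exactly the quantities
    -- of `gradient_bound`.
    have heq : 7 / 4 / zeta (step η k A B C) * (((4 / 7 * zeta A * x +
        (k * (4 / 7 * zeta C * z) * (B + η) + k * C * (4 / 7 * zeta B * y))) * (1 + k * C * B) -
        (A + k * C * (B + η)) * (k * (4 / 7 * zeta C * z) * B + k * C * (4 / 7 * zeta B * y))) /
        (1 + k * C * B) ^ 2) = (zeta A * (1 + k * C * B) * x +
          k * C * (1 - A - k * C * η) * zeta B * y + k * (B + η - A * B) * zeta C * z) /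
          (zeta (step η k A B C) * (1 + k * C * B) ^ 2) := by
      field_simp
      ring
    have : 0 < zeta (step η k A B C) * (1 + k * C * B) ^ 2 := by positivity
    refine le_trans (le_of_eq (congrArg _ heq)) ?_
    rw [abs_div, abs_of_pos this, div_le_iff₀ this]
    linarith
  choose! g hg hg' using key
  have := norm_image_sub_le_of_norm_deriv_le_segment_01' (f := G) (f' := g) (C := rate k₀ * δ)
    (fun s hs => (hg s hs).hasDerivWithinAt) (fun s hs => hg' s ⟨hs.1, hs.2.le⟩)
  simpa only [G, path_zero a ha, path_zero b hb, path_zero β hβ, path_one _ a' ha',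
    path_one _ b' hb', path_one _ β' hβ', Real.norm_eq_abs] using this

/-! ### The partition function as a recursion over the edges -/

/-- An edge with its two ends and its weight. -/
abbrev Edge := ℕ × ℕ × ℝ

/-- The vertex functions, as sequences. -/
abbrev State := ℕ → ℕ → ℝ

/-- The vertex functions with one more input at `v` pinned to `1`. -/
def shift (v : ℕ) (s : State) : State := fun x i => s x (i + if x = v then 1 else 0)

/-- The partition function of the graph with vertices `0, …, n - 1` and the given edges, where missing
edges are pinned to `0`. -/
noncomputable def partition (n : ℕ) : State → List Edge → ℝ
  | s, [] => ∏ x ∈ Finset.range n, s x 0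
  | s, (u, v, w) :: E => partition n s E + w * partition n (shift u (shift v s)) E

/-- All vertex functions are positive Fibonacci functions with ratios in `[c / 2, c + 2 / c]`. -/
structure IsFib (c : ℝ) (s : State) : Prop where
  pos : ∀ v, 0 < s v 0
  lower : ∀ v, c / 2 * s v 0 ≤ s v 1
  upper : ∀ v, s v 1 ≤ (c + 2 / c) * s v 0
  recurrence : ∀ v i, s v (i + 2) = c * s v (i + 1) + s v i

theorem shift_comm (u v : ℕ) (s : State) : shift u (shift v s) = shift v (shift u s) := by
  funext x i
  simp only [shift]
  congr 1
  omega

/-- The upper bound c + 2/c reproduces itself: f_2/f_1 = c + f_0/f_1, and f_0/f_1 ≤ 2/c by the lower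
bound. -/
theorem IsFib.shift {c : ℝ} (hc : 0 < c) {s : State} (h : IsFib c s) (v : ℕ) :
    IsFib c (shift v s) := by
  have h1 : ∀ x, 0 < s x 1 := fun x => (mul_pos (by positivity) (h.pos x)).trans_le (h.lower x)
  constructor <;> intro x <;> by_cases hx : x = v <;> simp only [FibHolant.shift, hx, if_true,
    if_false, add_zero, zero_add]
  · exact h1 v
  · exact h.pos x
  · have := h.recurrence v 0
    simp only [zero_add] at this
    rw [show 1 + 1 = 2 from rfl, this]
    nlinarith [h.pos v, h1 v]
  · exact h.lower x
  · have := h.recurrence v 0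
    simp only [zero_add] at this
    rw [show 1 + 1 = 2 from rfl, this]
    have h2 : s v 0 = 2 / c * (c / 2 * s v 0) := by field_simp
    have h3 : 2 / c * (c / 2 * s v 0) ≤ 2 / c * s v 1 :=
      mul_le_mul_of_nonneg_left (h.lower v) (by positivity)
    linarith
  · exact h.upper x
  · intro i
    exact h.recurrence v (i + 1)
  · exact h.recurrence x

/-- The other end and the weight of the first edge at `v`, and the remaining edges, if some edge
meets `v`. -/
noncomputable def extract (v : ℕ) : List Edge → Option ((ℕ × ℝ) × List Edge)
  | [] => none
  | (a, b, w) :: E =>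
    if a = v then some ((b, w), E)
    else if b = v then some ((a, w), E)
    else (extract v E).map fun r => (r.1, (a, b, w) :: r.2)

section

variable {n : ℕ} {c lam : ℝ}

theorem partition_pos (hc : 0 < c) (hlam : 0 < lam) {E : List Edge} (hE : ∀ e ∈ E, lam ≤ e.2.2)
    {s : State} (hs : IsFib c s) : 0 < partition n s E := by
  induction E generalizing s with
  | nil => exact Finset.prod_pos fun x _ => hs.pos x
  | cons e E ih =>
    obtain ⟨u, v, w⟩ := e
    have hE' : ∀ e ∈ E, lam ≤ e.2.2 := fun e he => hE e (List.mem_cons_of_mem _ he)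
    have hw : lam ≤ w := hE (u, v, w) List.mem_cons_self
    have h1 := ih hE' hs
    have h2 := ih hE' ((hs.shift hc v).shift hc u)
    have : 0 < w := by linarith
    rw [partition]
    positivity

theorem prod_shift_zero {v : ℕ} (hv : v < n) (s : State) :
    ∏ x ∈ Finset.range n, shift v s x 0 = s v 1 * ∏ x ∈ (Finset.range n).erase v, s x 0 := by
  rw [← Finset.mul_prod_erase _ _ (Finset.mem_range.2 hv)]
  congr 1
  · simp [shift]
  · refine Finset.prod_congr rfl fun x hx => ?_
    simp [shift, Finset.ne_of_mem_erase hx]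

theorem prod_zero_eq {v : ℕ} (hv : v < n) (s : State) :
    ∏ x ∈ Finset.range n, s x 0 = s v 0 * ∏ x ∈ (Finset.range n).erase v, s x 0 :=
  (Finset.mul_prod_erase _ _ (Finset.mem_range.2 hv)).symm

/-- The bounds hold at a single vertex and survive sums with nonnegative weights, while pinning
keeps the class of states. -/
theorem partition_shift_bounds (hc : 0 < c) (hlam : 0 < lam) {v : ℕ} (hv : v < n)
    {E : List Edge} (hE : ∀ e ∈ E, lam ≤ e.2.2) {s : State} (hs : IsFib c s) :
    c / 2 * partition n s E ≤ partition n (shift v s) E ∧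
      partition n (shift v s) E ≤ (c + 2 / c) * partition n s E := by
  induction E generalizing s with
  | nil =>
    simp only [partition]
    rw [prod_shift_zero hv, prod_zero_eq hv]
    have h := Finset.prod_nonneg (s := (Finset.range n).erase v) fun x _ => (hs.pos x).le
    constructor
    · nlinarith [mul_le_mul_of_nonneg_right (hs.lower v) h]
    · nlinarith [mul_le_mul_of_nonneg_right (hs.upper v) h]
  | cons e E ih =>
    obtain ⟨a, b, w⟩ := e
    have hE' : ∀ e ∈ E, lam ≤ e.2.2 := fun e he => hE e (List.mem_cons_of_mem _ he)
    have hw : 0 ≤ w := hlam.le.trans (hE (a, b, w) List.mem_cons_self)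
    have h1 := ih hE' hs
    have h2 := ih hE' ((hs.shift hc b).shift hc a)
    simp only [partition]
    rw [shift_comm b v, shift_comm a v]
    constructor
    · nlinarith [mul_le_mul_of_nonneg_left h2.1 hw]
    · nlinarith [mul_le_mul_of_nonneg_left h2.2 hw]

/-- The partition function is linear in the function at v, so the recurrence passes from v to the
whole graph. Two extra pinned ends at v thereby reduce to one and none, which closes the recursion
on marginals. -/
theorem partition_shift_shift (hc : 0 < c) {v : ℕ} (hv : v < n) (E : List Edge) {s : State}
    (hs : IsFib c s) : partition n (shift v (shift v s)) E =
      c * partition n (shift v s) E + partition n s E := by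
  induction E generalizing s with
  | nil =>
    simp only [partition]
    have h1 : ∏ x ∈ (Finset.range n).erase v, shift v s x 0 =
        ∏ x ∈ (Finset.range n).erase v, s x 0 :=
      Finset.prod_congr rfl fun x hx => by simp [shift, Finset.ne_of_mem_erase hx]
    rw [prod_shift_zero hv, h1, prod_shift_zero hv, prod_zero_eq hv]
    have := hs.recurrence v 0
    simp only [shift, if_true]
    rw [show 1 + 1 = 0 + 2 from rfl, this]
    ring
  | cons e E ih =>
    obtain ⟨a, b, w⟩ := e
    simp only [partition]
    rw [shift_comm b v, shift_comm a v, shift_comm b v, shift_comm a v, ih hs,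
      ih ((hs.shift hc b).shift hc a)]
    ring

/-- No remaining edge touches v, so its function contributes a separate factor. -/
theorem partition_of_extract_eq_none {v : ℕ} (hv : v < n) {E : List Edge}
    (h : extract v E = none) (s : State) :
    partition n (shift v s) E * s v 0 = s v 1 * partition n s E := by
  induction E generalizing s with
  | nil =>
    simp only [partition]
    rw [prod_shift_zero hv, prod_zero_eq hv]
    ring
  | cons e E ih =>
    obtain ⟨a, b, w⟩ := e
    simp only [extract] at h
    split_ifs at h with ha hb
    have h' : extract v E = none := by simpa using h
    have h1 := ih h' s
    have h2 := ih h' (shift a (shift b s))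
    have e0 : ∀ i, shift a (shift b s) v i = s v i := fun i => by
      simp [shift, Ne.symm ha, Ne.symm hb]
    rw [e0, e0] at h2
    simp only [partition]
    rw [shift_comm b v, shift_comm a v, add_mul, h1, mul_assoc, h2]
    ring

/-- Shifts commute, so the order in which edges are expanded is irrelevant. -/
theorem partition_of_extract_eq_some {v u : ℕ} {w : ℝ} {E E' : List Edge}
    (h : extract v E = some ((u, w), E')) (s : State) :
    partition n s E = partition n s E' + w * partition n (shift u (shift v s)) E' := by
  induction E generalizing s E' with
  | nil => simp [extract] at h
  | cons e E ih =>
    obtain ⟨a, b, x⟩ := e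
    simp only [extract] at h
    split_ifs at h with ha hb
    · simp only [Option.some.injEq, Prod.mk.injEq] at h
      obtain ⟨⟨rfl, rfl⟩, rfl⟩ := h
      rw [partition, ha, shift_comm]
    · simp only [Option.some.injEq, Prod.mk.injEq] at h
      obtain ⟨⟨rfl, rfl⟩, rfl⟩ := h
      rw [partition, hb]
    · simp only [Option.map_eq_some_iff, Prod.mk.injEq] at h
      obtain ⟨⟨r, F⟩, hF, h1, rfl⟩ := h
      obtain rfl : r = (u, w) := h1
      have hcomm : shift u (shift v (shift a (shift b s))) =
          shift a (shift b (shift u (shift v s))) := by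
        rw [shift_comm v a, shift_comm v b, shift_comm u a, shift_comm u b]
      simp only [partition]
      rw [ih hF, ih hF, hcomm]
      ring

theorem extract_sublist {v : ℕ} {r : (ℕ × ℝ)} {E E' : List Edge}
    (h : extract v E = some (r, E')) :
    E'.Sublist E ∧ ((v, r.1, r.2) ∈ E ∨ (r.1, v, r.2) ∈ E) := by
  induction E generalizing E' with
  | nil => simp [extract] at h
  | cons e E ih =>
    obtain ⟨a, b, x⟩ := e
    simp only [extract] at h
    split_ifs at h with ha hb
    · simp only [Option.some.injEq, Prod.mk.injEq] at h
      obtain ⟨rfl, rfl⟩ := h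
      exact ⟨List.sublist_cons_self _ _, Or.inl (by simp [ha])⟩
    · simp only [Option.some.injEq, Prod.mk.injEq] at h
      obtain ⟨rfl, rfl⟩ := h
      exact ⟨List.sublist_cons_self _ _, Or.inr (by simp [hb])⟩
    · simp only [Option.map_eq_some_iff, Prod.mk.injEq] at h
      obtain ⟨⟨r', F⟩, hF, h1, rfl⟩ := h
      obtain rfl : r' = r := h1
      have := ih hF
      exact ⟨this.1.cons_cons _, this.2.imp (List.mem_cons_of_mem _) (List.mem_cons_of_mem _)⟩

/-! ### Marginals and the truncated recursion -/

/-- The marginal ratio at the vertex `v`: an additional edge end at `v` pinned to `1` against one pinned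
to `0`. -/
noncomputable def marginal (n v : ℕ) (s : State) (E : List Edge) : ℝ :=
  partition n (shift v s) E / partition n s E

theorem marginal_bounds (hc : 0 < c) (hlam : 0 < lam) {v : ℕ} (hv : v < n) {E : List Edge}
    (hE : ∀ e ∈ E, lam ≤ e.2.2) {s : State} (hs : IsFib c s) :
    c / 2 ≤ marginal n v s E ∧ marginal n v s E ≤ c + 2 / c := by
  have h := partition_shift_bounds hc hlam hv hE hs
  have hp := partition_pos (n := n) hc hlam hE hs
  exact ⟨(le_div_iff₀ hp).2 h.1, (div_le_iff₀ hp).2 h.2⟩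

theorem marginal_of_extract_eq_none (hc : 0 < c) (hlam : 0 < lam) {v : ℕ} (hv : v < n)
    {E : List Edge} (hE : ∀ e ∈ E, lam ≤ e.2.2) {s : State} (hs : IsFib c s)
    (h : extract v E = none) : marginal n v s E = s v 1 / s v 0 := by
  have hp := partition_pos (n := n) hc hlam hE hs
  rw [marginal, div_eq_div_iff hp.ne' (hs.pos v).ne']
  exact partition_of_extract_eq_none hv h s

/-- Expand numerator and denominator along the edge and divide by the partition function of E'.
Pinning u and v in turn gives the product of the marginal at u and the marginal at v given u; the
doubly pinned v is removed by the recurrence. -/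
theorem marginal_of_extract_eq_some (hc : 0 < c) (hlam : 0 < lam) {v u : ℕ} (hv : v < n)
    {w : ℝ} {E E' : List Edge} (hE : ∀ e ∈ E, lam ≤ e.2.2) {s : State} (hs : IsFib c s)
    (h : extract v E = some ((u, w), E')) :
    marginal n v s E = (marginal n v s E' +
        w * marginal n u s E' * (c * marginal n v (shift u s) E' + 1)) /
      (1 + w * marginal n u s E' * marginal n v (shift u s) E') := by
  have hE' : ∀ e ∈ E', lam ≤ e.2.2 := fun e he => hE e ((extract_sublist h).1.subset he)
  have h00 := partition_pos (n := n) hc hlam hE' hs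
  have h01 := partition_pos (n := n) hc hlam hE' (hs.shift hc u)
  have h11 := partition_pos (n := n) hc hlam hE' ((hs.shift hc u).shift hc v)
  have hw : 0 < w := by
    rcases (extract_sublist h).2 with h | h <;> exact hlam.trans_le (hE _ h)
  simp only [marginal]
  rw [partition_of_extract_eq_some h, partition_of_extract_eq_some h s, shift_comm u v (shift v s),
    shift_comm u v s, partition_shift_shift hc hv E' (hs.shift hc u)]
  have : 0 < partition n s E' + w * partition n (shift v (shift u s)) E' := by positivity
  field_simp

/-- The recursion for the marginal, cut off at a given depth. -/
noncomputable def ratio (c : ℝ) : ℕ → ℕ → State → List Edge → ℝ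
  -- Any value in the interval of marginals would serve; this one is available without c.
  | 0, v, s, _ => s v 1 / s v 0
  | l + 1, v, s, E =>
    match extract v E with
    | none => s v 1 / s v 0
    | some ((u, w), E') =>
      (ratio c l v s E' + w * ratio c l u s E' * (c * ratio c l v (shift u s) E' + 1)) /
        (1 + w * ratio c l u s E' * ratio c l v (shift u s) E')

/-- The approximation of the partition function. -/
noncomputable def approx (n : ℕ) (c : ℝ) (l : ℕ) (s : State) : List Edge → ℝ
  | [] => ∏ x ∈ Finset.range n, s x 0
  | (u, v, w) :: E =>
    approx n c l s E * (1 + w * (ratio c l v s E * ratio c l u (shift v s) E))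

/-- In units of c only η = 1/c² and k = wc² remain; w ≥ λ becomes k ≥ λc². -/
theorem step_scale (hc : 0 < c) (w a b β : ℝ) :
    (a + w * β * (c * b + 1)) / (1 + w * β * b) / c =
      step (1 / c ^ 2) (w * c ^ 2) (a / c) (b / c) (β / c) := by
  unfold step
  rw [div_div, mul_comm _ c, ← div_div]
  congr 1
  · field_simp
  · field_simp

theorem mem_box_div (hc : 0 < c) {r : ℝ} :
    r / c ∈ box (1 / c ^ 2) ↔ c / 2 ≤ r ∧ r ≤ c + 2 / c := by
  unfold box
  rw [Set.mem_Icc, le_div_iff₀ hc, div_le_iff₀ hc]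
  have : (1 + 2 * (1 / c ^ 2)) * c = c + 2 / c := by field_simp
  rw [this, one_div_mul_eq_div]

theorem IsFib.div_mem_box (hc : 0 < c) {s : State} (hs : IsFib c s) (v : ℕ) :
    s v 1 / s v 0 / c ∈ box (1 / c ^ 2) :=
  (mem_box_div hc).2 ⟨(le_div_iff₀ (hs.pos v)).2 (hs.lower v),
    (div_le_iff₀ (hs.pos v)).2 (hs.upper v)⟩

theorem ratio_mem_box (hc : 0 < c) (hlam : 0 < lam) (l : ℕ) (v : ℕ) {s : State} (hs : IsFib c s)
    {E : List Edge} (hE : ∀ e ∈ E, lam ≤ e.2.2) :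
    ratio c l v s E / c ∈ box (1 / c ^ 2) := by
  induction l generalizing v s E with
  | zero => exact hs.div_mem_box hc v
  | succ l ih =>
    rw [ratio]
    split
    · exact hs.div_mem_box hc v
    · rename_i u w E' h
      have hE' : ∀ e ∈ E', lam ≤ e.2.2 := fun e he => hE e ((extract_sublist h).1.subset he)
      have hw : 0 < w := by
        rcases (extract_sublist h).2 with h | h <;> exact hlam.trans_le (hE _ h)
      rw [step_scale hc]
      exact step_mem_box (by positivity) (by positivity) (ih v hs hE') (ih v (hs.shift hc u) hE')
        (ih u hs hE')

theorem ratio_pos (hc : 0 < c) (hlam : 0 < lam) (l : ℕ) (v : ℕ) {s : State} (hs : IsFib c s)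
    {E : List Edge} (hE : ∀ e ∈ E, lam ≤ e.2.2) : 0 < ratio c l v s E := by
  have := ((mem_box_div hc).1 (ratio_mem_box hc hlam l v hs hE)).1
  linarith

/-- The arguments of the logarithms lie in [1/6, 2], and log t ≤ t - 1 at a quotient t ≤ 12 gives
11. -/
theorem potential_dist_le {η a b : ℝ} (hη' : η ≤ 0.1515) (ha : a ∈ box η)
    (hb : b ∈ box η) : |potential a - potential b| ≤ 11 := by
  have key : ∀ r ∈ box η, 1 / 6 ≤ (r - 1 / 4) / (2 - r) ∧ (r - 1 / 4) / (2 - r) ≤ 2 := by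
    intro r hr
    have h1 := hr.1
    have h2 := hr.2
    have : 0 < 2 - r := by linarith
    exact ⟨(le_div_iff₀ this).2 (by linarith), (div_le_iff₀ this).2 (by linarith)⟩
  have main : ∀ x y : ℝ, 1 / 6 ≤ x → y ≤ 2 → 0 < y → Real.log y - Real.log x ≤ 11 := by
    intro x y hx hy hy0
    have hx0 : 0 < x := by linarith
    rw [← Real.log_div hy0.ne' hx0.ne']
    refine (Real.log_le_sub_one_of_pos (by positivity)).trans ?_
    rw [sub_le_iff_le_add, div_le_iff₀ hx0]
    linarith
  have h1 := key a ha
  have h2 := key b hb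
  rw [abs_sub_le_iff]
  exact ⟨main _ _ h2.1 h1.2 (by linarith), main _ _ h1.1 h2.2 (by linarith)⟩

/-- Both (r - 1/4)/r and 1/(2 - r) increase with r, so the potential grows at least as fast as the
logarithm. Potential errors thus bound relative errors. -/
theorem log_dist_le_potential_dist {a b : ℝ} (ha : 1 / 4 < a) (ha' : a < 2) (hb : 1 / 4 < b)
    (hb' : b < 2) : |Real.log a - Real.log b| ≤ |potential a - potential b| := by
  wlog hab : a ≤ b generalizing a b
  · rw [abs_sub_comm, abs_sub_comm (potential a)]
    exact this hb hb' ha ha' (le_of_not_ge hab)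
  have h1 : Real.log a ≤ Real.log b := Real.log_le_log (by linarith) hab
  rw [abs_sub_comm, abs_of_nonneg (by linarith), abs_sub_comm]
  refine le_trans ?_ (le_abs_self _)
  have h2 : 0 < 2 - a := by linarith
  have h3 : 0 < 2 - b := by linarith
  have h4 : 0 < a - 1 / 4 := by linarith
  have h5 : 0 < b - 1 / 4 := by linarith
  have h6 : 0 < a := by linarith
  have h7 : 0 < b := by linarith
  unfold potential
  rw [← Real.log_div (by positivity) (by positivity), ← Real.log_div (by positivity) (by positivity)]
  refine Real.log_le_log (by positivity) ?_
  rw [div_le_div_iff₀ (by positivity) (by positivity), div_mul_eq_mul_div, mul_div_assoc', mul_comm,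
    div_le_div_iff₀ h2 h3]
  nlinarith [mul_nonneg (sub_nonneg.2 hab) h4.le, mul_pos h6 h7, mul_nonneg (sub_nonneg.2 hab) (mul_pos h6 h7).le]

/-- Exact and truncated marginals obey the same recursion, so every level contributes one factor
`rate`; 11 is the initial error. -/
theorem potential_marginal_ratio (hc : 2.57 ≤ c) (hlam : 0 < lam) (l : ℕ) {v : ℕ} (hv : v < n)
    {s : State} (hs : IsFib c s) {E : List Edge}
    (hE : ∀ e ∈ E, e.1 < n ∧ e.2.1 < n ∧ lam ≤ e.2.2) :
    |potential (marginal n v s E / c) - potential (ratio c l v s E / c)| ≤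
      rate (lam * c ^ 2) ^ l * 11 := by
  have hc0 : 0 < c := by linarith
  have hη : 1 / c ^ 2 ≤ 0.1515 := by
    rw [div_le_iff₀ (by positivity)]
    nlinarith
  have hbox : ∀ v < n, ∀ s, IsFib c s → ∀ E : List Edge, (∀ e ∈ E, e.1 < n ∧ e.2.1 < n ∧ lam ≤ e.2.2) →
      marginal n v s E / c ∈ box (1 / c ^ 2) := fun v hv s hs E hE =>
    (mem_box_div hc0).2 (marginal_bounds hc0 hlam hv (fun e he => (hE e he).2.2) hs)
  have hr := rate_pos (k := lam * c ^ 2) (by positivity)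
  induction l generalizing v s E with
  | zero =>
    rw [pow_zero, one_mul]
    exact potential_dist_le hη (hbox v hv s hs E hE) (hs.div_mem_box hc0 v)
  | succ l ih =>
    rw [ratio]
    have hE₀ : ∀ e ∈ E, lam ≤ e.2.2 := fun e he => (hE e he).2.2
    split
    · rename_i h
      rw [marginal_of_extract_eq_none hc0 hlam hv hE₀ hs h, sub_self, abs_zero]
      positivity
    · rename_i u w E' h
      have hE' : ∀ e ∈ E', e.1 < n ∧ e.2.1 < n ∧ lam ≤ e.2.2 :=
        fun e he => hE e ((extract_sublist h).1.subset he)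
      have hE'₀ : ∀ e ∈ E', lam ≤ e.2.2 := fun e he => (hE' e he).2.2
      have hwu : lam ≤ w ∧ u < n := by
        rcases (extract_sublist h).2 with h | h
        · exact ⟨(hE _ h).2.2, (hE _ h).2.1⟩
        · exact ⟨(hE _ h).2.2, (hE _ h).1⟩
      rw [marginal_of_extract_eq_some hc0 hlam hv hE₀ hs h, step_scale hc0, step_scale hc0,
        pow_succ' (rate _), mul_assoc]
      exact potential_step_contract (by positivity) hη (by positivity)
        (mul_le_mul_of_nonneg_right hwu.1 (by positivity))
        (ratio_mem_box hc0 hlam l v hs hE'₀) (ratio_mem_box hc0 hlam l v (hs.shift hc0 u) hE'₀)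
        (ratio_mem_box hc0 hlam l u hs hE'₀) (hbox v hv s hs E' hE')
        (hbox v hv _ (hs.shift hc0 u) E' hE') (hbox u hwu.2 s hs E' hE')
        (ih hv hs hE') (ih hv (hs.shift hc0 u) hE') (ih hwu.2 hs hE')

/-! ### Multiplicative errors and the telescoping product -/

/-- `a` and `b` agree up to a factor `exp δ`. -/
def Near (δ a b : ℝ) : Prop := a ≤ Real.exp δ * b ∧ b ≤ Real.exp δ * a

theorem Near.mul {δ δ' a b a' b' : ℝ} (h : Near δ a b) (h' : Near δ' a' b') (ha : 0 ≤ a)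
    (hb : 0 ≤ b) (ha' : 0 ≤ a') (hb' : 0 ≤ b') : Near (δ + δ') (a * a') (b * b') := by
  constructor
  · calc a * a' ≤ (Real.exp δ * b) * (Real.exp δ' * b') := mul_le_mul h.1 h'.1 ha' (by positivity)
      _ = _ := by rw [Real.exp_add]; ring
  · calc b * b' ≤ (Real.exp δ * a) * (Real.exp δ' * a') := mul_le_mul h.2 h'.2 hb' (by positivity)
      _ = _ := by rw [Real.exp_add]; ring

theorem Near.one_add_mul {δ a b w : ℝ} (h : Near δ a b) (hδ : 0 ≤ δ) (hw : 0 ≤ w) :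
    Near δ (1 + w * a) (1 + w * b) := by
  have h1 : 1 ≤ Real.exp δ := Real.one_le_exp hδ
  exact ⟨by nlinarith [mul_le_mul_of_nonneg_left h.1 hw],
    by nlinarith [mul_le_mul_of_nonneg_left h.2 hw]⟩

theorem near_of_log_dist {δ a b : ℝ} (ha : 0 < a) (hb : 0 < b)
    (h : |Real.log a - Real.log b| ≤ δ) : Near δ a b := by
  rw [abs_sub_le_iff] at h
  constructor
  · calc a = Real.exp (Real.log a) := (Real.exp_log ha).symm
      _ ≤ Real.exp (δ + Real.log b) := Real.exp_le_exp.2 (by linarith)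
      _ = _ := by rw [Real.exp_add, Real.exp_log hb]
  · calc b = Real.exp (Real.log b) := (Real.exp_log hb).symm
      _ ≤ Real.exp (δ + Real.log a) := Real.exp_le_exp.2 (by linarith)
      _ = _ := by rw [Real.exp_add, Real.exp_log ha]

theorem near_marginal_ratio (hc : 2.57 ≤ c) (hlam : 0 < lam) (l : ℕ) {v : ℕ} (hv : v < n)
    {s : State} (hs : IsFib c s) {E : List Edge}
    (hE : ∀ e ∈ E, e.1 < n ∧ e.2.1 < n ∧ lam ≤ e.2.2) :
    Near (rate (lam * c ^ 2) ^ l * 11) (marginal n v s E) (ratio c l v s E) := by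
  have hc0 : 0 < c := by linarith
  have hη : 1 / c ^ 2 ≤ 0.1515 := by
    rw [div_le_iff₀ (by positivity)]
    nlinarith
  have hE₀ : ∀ e ∈ E, lam ≤ e.2.2 := fun e he => (hE e he).2.2
  have hm := marginal_bounds hc0 hlam hv hE₀ hs
  have h1 := (mem_box_div hc0).2 hm
  have h2 := ratio_mem_box hc0 hlam l v hs hE₀
  have hr := ratio_pos hc0 hlam l v hs hE₀
  have hm0 : 0 < marginal n v s E := by linarith [hm.1]
  refine near_of_log_dist hm0 hr ?_
  have h3 := log_dist_le_potential_dist (a := marginal n v s E / c) (b := ratio c l v s E / c)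
    (by linarith [h1.1]) (by linarith [h1.2]) (by linarith [h2.1]) (by linarith [h2.2])
  rw [Real.log_div hm0.ne' hc0.ne', Real.log_div hr.ne' hc0.ne', sub_sub_sub_cancel_right] at h3
  exact h3.trans (potential_marginal_ratio hc hlam l hv hs hE)

theorem approx_pos (hc : 0 < c) (hlam : 0 < lam) (l : ℕ) {s : State} (hs : IsFib c s)
    {E : List Edge} (hE : ∀ e ∈ E, lam ≤ e.2.2) : 0 < approx n c l s E := by
  induction E with
  | nil => exact Finset.prod_pos fun x _ => hs.pos x
  | cons e E ih =>
    obtain ⟨u, v, w⟩ := e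
    have hE' : ∀ e ∈ E, lam ≤ e.2.2 := fun e he => hE e (List.mem_cons_of_mem _ he)
    have hw : 0 < w := hlam.trans_le (hE (u, v, w) List.mem_cons_self)
    have h1 := ih hE'
    have h2 := ratio_pos hc hlam l v hs hE'
    have h3 := ratio_pos hc hlam l u (hs.shift hc v) hE'
    rw [approx]
    positivity

/-- The approximation of the partition function is good. -/
theorem near_partition_approx (hc : 2.57 ≤ c) (hlam : 0 < lam) (l : ℕ) {s : State}
    (hs : IsFib c s) {E : List Edge} (hE : ∀ e ∈ E, e.1 < n ∧ e.2.1 < n ∧ lam ≤ e.2.2) :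
    Near (E.length * (2 * (rate (lam * c ^ 2) ^ l * 11))) (partition n s E) (approx n c l s E) := by
  have hc0 : 0 < c := by linarith
  induction E with
  | nil => simp [Near, partition, approx]
  | cons e E ih =>
    obtain ⟨u, v, w⟩ := e
    have hE' : ∀ e ∈ E, e.1 < n ∧ e.2.1 < n ∧ lam ≤ e.2.2 :=
      fun e he => hE e (List.mem_cons_of_mem _ he)
    have hE'₀ : ∀ e ∈ E, lam ≤ e.2.2 := fun e he => (hE' e he).2.2
    obtain ⟨hu, hv, hw⟩ := hE (u, v, w) List.mem_cons_self
    simp only at hu hv hw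
    have hw0 : 0 < w := hlam.trans_le hw
    have hs' := hs.shift hc0 v
    have h1 := near_marginal_ratio hc hlam l hv hs hE'
    have h2 := near_marginal_ratio hc hlam l hu hs' hE'
    have r1 := ratio_pos hc0 hlam l v hs hE'₀
    have r2 := ratio_pos hc0 hlam l u hs' hE'₀
    have m1 : 0 < marginal n v s E := by linarith [(marginal_bounds hc0 hlam hv hE'₀ hs).1]
    have m2 : 0 < marginal n u (shift v s) E := by
      linarith [(marginal_bounds hc0 hlam hu hE'₀ hs').1]
    have p0 := partition_pos (n := n) hc0 hlam hE'₀ hs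
    have p1 := partition_pos (n := n) hc0 hlam hE'₀ hs'
    have a0 := approx_pos (n := n) hc0 hlam l hs hE'₀
    have hδ : 0 ≤ rate (lam * c ^ 2) ^ l * 11 := by
      have := rate_pos (k := lam * c ^ 2) (by positivity)
      positivity
    have h3 := (h1.mul h2 m1.le r1.le m2.le r2.le).one_add_mul (by linarith) hw0.le
    have h4 := (ih hE').mul h3 p0.le a0.le (by positivity) (by positivity)
    -- The doubly pinned term over the unpinned one is a product of two marginals, the second taken
    -- after pinning v.
    have e1 : partition n s ((u, v, w) :: E) =
        partition n s E * (1 + w * (marginal n v s E * marginal n u (shift v s) E)) := by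
      simp only [partition, marginal]
      field_simp
    rw [e1, approx]
    convert h4 using 1
    push_cast [List.length_cons]
    ring

end

/-! ### Cost models and derived rules for the cost semantics -/

open RealProg

/-- A cost measure `w`, together with a set `P` of numbers closed under the field operations on
which the operations increase the cost in a controlled way. -/
structure CostModel (w : ℝ → ℕ) (P : ℝ → Prop) : Prop where
  nat : ∀ k : ℕ, P k ∧ w k ≤ k + 1
  -- No cost bound is demanded: the program has finitely many constants, and their costs are
  -- absorbed into S.
  rat : ∀ q : ℚ, P q
  add : ∀ x y, P x → P y → P (x + y) ∧ w (x + y) ≤ 2 * (w x + w y) + 1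
  sub : ∀ x y, P x → P y → P (x - y) ∧ w (x - y) ≤ 2 * (w x + w y) + 1
  mul : ∀ x y, P x → P y → P (x * y) ∧ w (x * y) ≤ w x + w y
  div : ∀ x y, P x → P y → P (x / y) ∧ w (x / y) ≤ w x + w y

theorem CostModel.zero {w : ℝ → ℕ} {P : ℝ → Prop} (M : CostModel w P) : P 0 ∧ w 0 ≤ 1 := by
  simpa using M.nat 0

theorem CostModel.one {w : ℝ → ℕ} {P : ℝ → Prop} (M : CostModel w P) : P 1 ∧ w 1 ≤ 2 := by
  simpa using M.nat 1

/-- The term `e` evaluates to `v` at cost at most `T`. -/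
def Costs (w : ℝ → ℕ) (fs : List Term) (env : List Val) (e : Term) (v : Val) (T : ℕ) : Prop :=
  ∃ t, Eval w fs env e v t ∧ t ≤ T

namespace Costs

variable {w : ℝ → ℕ} {fs : List Term} {env : List Val} {a b e₁ e₂ body : Term} {u v p q : Val}
  {x y : ℝ} {r s t T T' i f : ℕ}

theorem mono (h : Costs w fs env a v T) (hT : T ≤ T') : Costs w fs env a v T' :=
  let ⟨t, ht, hle⟩ := h
  ⟨t, ht, hle.trans hT⟩

theorem var (h : env[i]? = some v) : Costs w fs env (.var i) v 1 := ⟨1, .var h, le_rfl⟩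

theorem const (q : ℚ) : Costs w fs env (.const q) (.num q) 1 := ⟨1, .const q, le_rfl⟩

theorem zero : Costs w fs env (.const 0) (.num 0) 1 := by simpa using const (w := w) 0

theorem one : Costs w fs env (.const 1) (.num 1) 1 := by simpa using const (w := w) 1

theorem nil : Costs w fs env .nil .nil 1 := ⟨1, .nil, le_rfl⟩

theorem cons (ha : Costs w fs env a u s) (hb : Costs w fs env b v t) :
    Costs w fs env (.cons a b) (.cons u v) (s + t + 1) := by
  obtain ⟨s', ha, hs⟩ := ha
  obtain ⟨t', hb, ht⟩ := hb
  exact ⟨_, .cons ha hb, by omega⟩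

theorem arith (o : Op) (ha : Costs w fs env a (.num x) s) (hb : Costs w fs env b (.num y) t)
    (hdiv : o = Op.div → y ≠ 0) :
    Costs w fs env (.arith o a b) (.num (o.apply x y)) (s + t + 1 + (w x + w y + w (o.apply x y))) := by
  obtain ⟨s', ha, hs⟩ := ha
  obtain ⟨t', hb, ht⟩ := hb
  exact ⟨_, .arith ha hb hdiv, by omega⟩

theorem add (ha : Costs w fs env a (.num x) s) (hb : Costs w fs env b (.num y) t) :
    Costs w fs env (.arith .add a b) (.num (x + y)) (s + t + 1 + (w x + w y + w (x + y))) :=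
  arith .add ha hb (by simp)

theorem sub (ha : Costs w fs env a (.num x) s) (hb : Costs w fs env b (.num y) t) :
    Costs w fs env (.arith .sub a b) (.num (x - y)) (s + t + 1 + (w x + w y + w (x - y))) :=
  arith .sub ha hb (by simp)

theorem mul (ha : Costs w fs env a (.num x) s) (hb : Costs w fs env b (.num y) t) :
    Costs w fs env (.arith .mul a b) (.num (x * y)) (s + t + 1 + (w x + w y + w (x * y))) :=
  arith .mul ha hb (by simp)

theorem div (ha : Costs w fs env a (.num x) s) (hb : Costs w fs env b (.num y) t) (hy : y ≠ 0) :
    Costs w fs env (.arith .div a b) (.num (x / y)) (s + t + 1 + (w x + w y + w (x / y))) :=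
  arith .div ha hb fun _ => hy

theorem bind (ha : Costs w fs env a u s) (hb : Costs w fs (u :: env) b v t) :
    Costs w fs env (.bind a b) v (s + t + 1) := by
  obtain ⟨s', ha, hs⟩ := ha
  obtain ⟨t', hb, ht⟩ := hb
  exact ⟨_, .bind ha hb, by omega⟩

theorem ifLe_true (ha : Costs w fs env a (.num x) r) (hb : Costs w fs env b (.num y) s)
    (hxy : x ≤ y) (he : Costs w fs env e₁ v t) :
    Costs w fs env (.ifLe a b e₁ e₂) v (r + s + t + 1 + (w x + w y)) := by
  obtain ⟨r', ha, hr⟩ := ha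
  obtain ⟨s', hb, hs⟩ := hb
  obtain ⟨t', he, ht⟩ := he
  exact ⟨_, .ifLe_true ha hb hxy he, by omega⟩

theorem ifLe_false (ha : Costs w fs env a (.num x) r) (hb : Costs w fs env b (.num y) s)
    (hxy : ¬ x ≤ y) (he : Costs w fs env e₂ v t) :
    Costs w fs env (.ifLe a b e₁ e₂) v (r + s + t + 1 + (w x + w y)) := by
  obtain ⟨r', ha, hr⟩ := ha
  obtain ⟨s', hb, hs⟩ := hb
  obtain ⟨t', he, ht⟩ := he
  exact ⟨_, .ifLe_false ha hb hxy he, by omega⟩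

theorem split_nil (ha : Costs w fs env a .nil s) (he : Costs w fs env e₁ v t) :
    Costs w fs env (.split a e₁ e₂) v (s + t + 1) := by
  obtain ⟨s', ha, hs⟩ := ha
  obtain ⟨t', he, ht⟩ := he
  exact ⟨_, .split_nil ha he, by omega⟩

theorem split_cons (ha : Costs w fs env a (.cons p q) s)
    (he : Costs w fs (p :: q :: env) e₂ v t) :
    Costs w fs env (.split a e₁ e₂) v (s + t + 1) := by
  obtain ⟨s', ha, hs⟩ := ha
  obtain ⟨t', he, ht⟩ := he
  exact ⟨_, .split_cons ha he, by omega⟩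

theorem call (hf : fs[f]? = some body) (ha : Costs w fs env a u s)
    (hb : Costs w fs [u] body v t) : Costs w fs env (.call f a) v (s + t + 1) := by
  obtain ⟨s', ha, hs⟩ := ha
  obtain ⟨t', hb, ht⟩ := hb
  exact ⟨_, .call hf ha hb, by omega⟩

end Costs

/-- `s` if `a = b`, and `t` otherwise. -/
def ifEq (a b s t : Term) : Term := .ifLe a b (.ifLe b a s t) t

theorem Costs.ifEq_true {w : ℝ → ℕ} {fs : List Term} {env : List Val} {a b e₁ e₂ : Term} {v : Val}
    {x : ℝ} {r s t : ℕ} (ha : Costs w fs env a (.num x) r) (hb : Costs w fs env b (.num x) s)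
    (he : Costs w fs env e₁ v t) :
    Costs w fs env (ifEq a b e₁ e₂) v (2 * (r + s + 1 + (w x + w x)) + t) :=
  (Costs.ifLe_true ha hb le_rfl (.ifLe_true hb ha le_rfl he)).mono (by omega)

theorem Costs.ifEq_false {w : ℝ → ℕ} {fs : List Term} {env : List Val} {a b e₁ e₂ : Term} {v : Val}
    {x y : ℝ} {r s t : ℕ} (ha : Costs w fs env a (.num x) r) (hb : Costs w fs env b (.num y) s)
    (hxy : x ≠ y) (he : Costs w fs env e₂ v t) :
    Costs w fs env (ifEq a b e₁ e₂) v (2 * (r + s + 1 + (w x + w y)) + t) := by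
  by_cases h : x ≤ y
  · exact (Costs.ifLe_true ha hb h
      (.ifLe_false hb ha (not_le.2 (lt_of_le_of_ne h hxy)) he)).mono (by omega)
  · exact (Costs.ifLe_false ha hb h he).mono (by omega)

/-! ### The program -/

/-- A list of empty lists that is long enough: the least `l` with `1 ≤ y * β ^ l`. -/
def fuelTerm (β : ℚ) : Term :=
  .ifLe (.const 1) (.var 0) .nil (.cons .nil (.call 0 (.arith .mul (.var 0) (.const β))))

/-- Argument `(v . sigs)`: the vertex functions with the first value of the one at `v` removed. -/
def tailTerm : Term :=
  .split (.var 0) .nil (.split (.var 1) .nil (.ifLe (.var 2) (.const 0)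
    (.cons (.split (.var 0) .nil (.var 1)) (.var 1))
    (.cons (.var 0) (.call 1 (.cons (.arith .sub (.var 2) (.const 1)) (.var 1))))))

/-- Argument `(v . sigs)`: the vertex function at `v`. -/
def getTerm : Term :=
  .split (.var 0) .nil (.split (.var 1) .nil (.ifLe (.var 2) (.const 0) (.var 0)
    (.call 2 (.cons (.arith .sub (.var 2) (.const 1)) (.var 1)))))

/-- Argument `(v . edges)`: `nil` if no edge meets `v`, and else the other end and the weight of such
an edge, and the remaining edges. -/
def extractTerm : Term :=
  .split (.var 0) .nil (.split (.var 1) .nil (.split (.var 0) .nil (.split (.var 0) .nil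
    (ifEq (.var 0) (.var 6) (.cons (.cons (.var 1) (.var 3)) (.var 5))
      (ifEq (.var 1) (.var 6) (.cons (.cons (.var 0) (.var 3)) (.var 5))
        (.split (.call 3 (.cons (.var 6) (.var 5))) .nil
          (.cons (.var 0) (.cons (.var 6) (.var 1)))))))))

/-- Argument `(fuel . (v . (sigs . edges)))`: the approximate marginal ratio at `v`. -/
def ratioTerm : Term :=
  .split (.var 0) .nil (.split (.var 1) .nil (.split (.var 1) .nil
    (.bind (.call 2 (.cons (.var 2) (.var 0)))
      (.split (.var 0) .nil (.split (.var 1) .nil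
        (.split (.var 9) (.arith .div (.var 0) (.var 2))
          (.split (.call 3 (.cons (.var 9) (.var 8))) (.arith .div (.var 2) (.var 4))
            (.split (.var 0) .nil (.split (.var 7) .nil
              (.bind (.call 4 (.cons (.var 7) (.cons (.var 15) (.cons (.var 13) (.var 5)))))
              (.bind (.call 4 (.cons (.var 8) (.cons (.var 3) (.cons (.var 14) (.var 6)))))
              (.bind (.call 4 (.cons (.var 9) (.cons (.var 17)
                (.cons (.call 1 (.cons (.var 4) (.var 15))) (.var 7)))))
              (.bind (.arith .mul (.var 6) (.var 1))
              (.arith .div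
                (.arith .add (.var 3) (.arith .mul (.var 0) (.arith .add
                  (.arith .mul (.arith .div (.arith .sub (.var 4) (.var 14)) (.var 12)) (.var 1))
                  (.const 1))))
                (.arith .add (.const 1) (.arith .mul (.var 0) (.var 1)))))))))))))))))

/-- Argument `edges`: their number plus one. -/
def countTerm : Term :=
  .split (.var 0) (.const 1) (.arith .add (.const 1) (.call 5 (.var 1)))

/-- Argument `sigs`: the product of the first values. -/
def headsTerm : Term :=
  .split (.var 0) (.const 1) (.split (.var 0) .nil (.arith .mul (.var 0) (.call 6 (.var 3))))

/-- Argument `(fuel . (sigs . edges))`: the approximate partition function. -/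
def approxTerm : Term :=
  .split (.var 0) .nil (.split (.var 1) .nil (.split (.var 1) (.call 6 (.var 0))
    (.split (.var 0) .nil (.split (.var 0) .nil
      (.arith .mul (.call 7 (.cons (.var 8) (.cons (.var 6) (.var 5))))
        (.arith .add (.const 1) (.arith .mul (.var 3) (.arith .mul
          (.call 4 (.cons (.var 8) (.cons (.var 1) (.cons (.var 6) (.var 5)))))
          (.call 4 (.cons (.var 8) (.cons (.var 0)
            (.cons (.call 1 (.cons (.var 1) (.var 6))) (.var 5)))))))))))))

/-- The functions of the program. -/
def functions (β : ℚ) : List Term :=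
  [fuelTerm β, tailTerm, getTerm, extractTerm, ratioTerm, countTerm, headsTerm, approxTerm]

/-- The approximation scheme. -/
def program (β κ : ℚ) : Program where
  funs := functions β
  main := .split (.var 0) .nil (.split (.var 1) .nil
    (.ifLe (.call 6 (.var 0)) (.const 0) (.const 0)
      (.call 7 (.cons
        (.call 0 (.arith .mul (.const κ) (.arith .div
          (.arith .div (.var 2) (.arith .add (.const 1) (.var 2))) (.call 5 (.var 1)))))
        (.cons (.var 0) (.var 1))))))

/-! ### Encodings -/

/-- A vertex function as a value. -/
noncomputable def encodeSig (l : List ℝ) : Val := .ofList (l.map .num)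

/-- The list of the vertex functions as a value. -/
noncomputable def encodeSigs (sigs : List (List ℝ)) : Val := .ofList (sigs.map encodeSig)

/-- An edge as a value. -/
noncomputable def encodeEdge (e : Edge) : Val := .cons (.cons (.num e.1) (.num e.2.1)) (.num e.2.2)

/-- A list of edges as a value. -/
noncomputable def encodeEdges (E : List Edge) : Val := .ofList (E.map encodeEdge)

/-- A depth as a value. -/
def encodeFuel (l : ℕ) : Val := .ofList (List.replicate l .nil)

/-- The result of the search for an edge as a value. -/
noncomputable def encodeExtract : Option ((ℕ × ℝ) × List Edge) → Val
  | none => .nil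
  | some (r, E) => .cons (.cons (.num r.1) (.num r.2)) (encodeEdges E)

section

variable {w : ℝ → ℕ} {P : ℝ → Prop} {β : ℚ}

/-- The bound is quadratic because each of the v + 1 rounds handles an index, whose cost a model
bounds only linearly. -/
theorem costs_get (M : CostModel w P) {v : ℕ} {sigs : List (List ℝ)} {l : List ℝ}
    (h : sigs[v]? = some l) :
    Costs w (functions β) [.cons (.num v) (encodeSigs sigs)] getTerm (encodeSig l)
      (20 * (v + 1) ^ 2) := by
  induction v generalizing sigs with
  | zero =>
    cases sigs with
    | nil => simp at h
    | cons l' sigs =>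
      obtain rfl : l' = l := by simpa using h
      have h0 := M.zero
      rw [Nat.cast_zero]
      refine (Costs.split_cons (.var rfl) (.split_cons (.var rfl)
        (.ifLe_true (.var rfl) .zero le_rfl (.var rfl)))).mono ?_
      omega
  | succ v ih =>
    cases sigs with
    | nil => simp at h
    | cons l' sigs =>
      have h0 := M.zero
      have h1 := M.one
      have h2 := M.nat v
      have h3 := M.nat (v + 1)
      have hv : ((v + 1 : ℕ) : ℝ) - 1 = v := by push_cast; ring
      have hpos : ¬ ((v + 1 : ℕ) : ℝ) ≤ 0 := not_le.2 (by positivity)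
      have hs := Costs.sub (w := w) (fs := functions β)
        (env := [encodeSig l', encodeSigs sigs, .num ((v + 1 : ℕ) : ℝ),
          encodeSigs (l' :: sigs), .cons (.num ((v + 1 : ℕ) : ℝ)) (encodeSigs (l' :: sigs))])
        (a := .var 2) (b := .const 1) (.var rfl) .one
      rw [hv] at hs
      refine (Costs.split_cons (.var rfl) (.split_cons (.var rfl)
        (.ifLe_false (.var rfl) .zero hpos
          (.call rfl (.cons hs (.var rfl)) (ih (by simpa using h)))))).mono ?_
      have : 20 * (v + 1 + 1) ^ 2 = 20 * (v + 1) ^ 2 + 40 * v + 60 := by ring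
      omega

theorem costs_tail (M : CostModel w P) {v : ℕ} {sigs : List (List ℝ)} (hv : v < sigs.length) :
    Costs w (functions β) [.cons (.num v) (encodeSigs sigs)] tailTerm
      (encodeSigs (sigs.modify v List.tail)) (20 * (v + 1) ^ 2) := by
  induction v generalizing sigs with
  | zero =>
    cases sigs with
    | nil => simp at hv
    | cons l sigs =>
      have h0 := M.zero
      rw [Nat.cast_zero]
      have ht : ∀ env, Costs w (functions β) (encodeSig l :: env)
          (.split (.var 0) .nil (.var 1)) (encodeSig l.tail) 3 := by
        intro env
        cases l with
        | nil => exact .split_nil (.var rfl) .nil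
        | cons x l => exact .split_cons (.var rfl) (.var rfl)
      refine (Costs.split_cons (.var rfl) (.split_cons (.var rfl)
        (.ifLe_true (.var rfl) .zero le_rfl (.cons (ht _) (.var rfl))))).mono ?_
      omega
  | succ v ih =>
    cases sigs with
    | nil => simp at hv
    | cons l' sigs =>
      have h0 := M.zero
      have h1 := M.one
      have h2 := M.nat v
      have h3 := M.nat (v + 1)
      have hv' : ((v + 1 : ℕ) : ℝ) - 1 = v := by push_cast; ring
      have hpos : ¬ ((v + 1 : ℕ) : ℝ) ≤ 0 := not_le.2 (by positivity)
      have hs := Costs.sub (w := w) (fs := functions β)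
        (env := [encodeSig l', encodeSigs sigs, .num ((v + 1 : ℕ) : ℝ),
          encodeSigs (l' :: sigs), .cons (.num ((v + 1 : ℕ) : ℝ)) (encodeSigs (l' :: sigs))])
        (a := .var 2) (b := .const 1) (.var rfl) .one
      rw [hv'] at hs
      refine (Costs.split_cons (.var rfl) (.split_cons (.var rfl)
        (.ifLe_false (.var rfl) .zero hpos (.cons (.var rfl)
          (.call rfl (.cons hs (.var rfl)) (ih (by simpa using hv))))))).mono ?_
      have : 20 * (v + 1 + 1) ^ 2 = 20 * (v + 1) ^ 2 + 40 * v + 60 := by ring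
      omega

theorem costs_extract (M : CostModel w P) {n v : ℕ} (hv : v < n) {E : List Edge}
    (hE : ∀ e ∈ E, e.1 < n ∧ e.2.1 < n) :
    Costs w (functions β) [.cons (.num v) (encodeEdges E)] extractTerm
      (encodeExtract (extract v E)) ((E.length + 1) * (8 * n + 60)) := by
  induction E with
  | nil =>
    refine (Costs.split_cons (.var rfl) (.split_nil (.var rfl) .nil)).mono ?_
    simp only [List.length_nil]
    omega
  | cons e E ih =>
    obtain ⟨a, b, x⟩ := e
    obtain ⟨ha, hb⟩ := hE (a, b, x) List.mem_cons_self
    simp only at ha hb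
    have ih := ih fun e he => hE e (List.mem_cons_of_mem _ he)
    have ha' := M.nat a
    have hb' := M.nat b
    have hv' := M.nat v
    have hlen : ((a, b, x) :: E).length + 1 = E.length + 1 + 1 := rfl
    rw [hlen, add_mul _ 1, extract]
    by_cases h1 : a = v
    · subst h1
      rw [if_pos rfl]
      refine (Costs.split_cons (.var rfl) (.split_cons (.var rfl) (.split_cons (.var rfl)
        (.split_cons (.var rfl) (.ifEq_true (.var rfl) (.var rfl)
          (.cons (.cons (.var rfl) (.var rfl)) (.var rfl))))))).mono ?_
      dsimp only
      omega
    · rw [if_neg h1]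
      have h1' : (a : ℝ) ≠ v := by exact_mod_cast h1
      by_cases h2 : b = v
      · subst h2
        rw [if_pos rfl]
        refine (Costs.split_cons (.var rfl) (.split_cons (.var rfl) (.split_cons (.var rfl)
          (.split_cons (.var rfl) (.ifEq_false (.var rfl) (.var rfl) h1'
            (.ifEq_true (.var rfl) (.var rfl)
              (.cons (.cons (.var rfl) (.var rfl)) (.var rfl)))))))).mono ?_
        dsimp only
        omega
      · rw [if_neg h2]
        have h2' : (b : ℝ) ≠ v := by exact_mod_cast h2
        cases hx : extract v E with
        | none =>
          rw [hx] at ih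
          refine (Costs.split_cons (.var rfl) (.split_cons (.var rfl) (.split_cons (.var rfl)
            (.split_cons (.var rfl) (.ifEq_false (.var rfl) (.var rfl) h1'
              (.ifEq_false (.var rfl) (.var rfl) h2'
                (.split_nil (.call rfl (.cons (.var rfl) (.var rfl)) ih) .nil))))))).mono ?_
          omega
        | some r =>
          rw [hx] at ih
          refine (Costs.split_cons (.var rfl) (.split_cons (.var rfl) (.split_cons (.var rfl)
            (.split_cons (.var rfl) (.ifEq_false (.var rfl) (.var rfl) h1'
              (.ifEq_false (.var rfl) (.var rfl) h2'
                (.split_cons (.call rfl (.cons (.var rfl) (.var rfl)) ih)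
                  (.cons (.var rfl) (.cons (.var rfl) (.var rfl)))))))))).mono ?_
          omega

end

/-! ### Value and cost of the recursive functions -/

/-- The number of edge ends at a vertex. -/
def degree : List Edge → ℕ → ℕ
  | [], _ => 0
  | (a, b, _) :: E, x => degree E x + (if x = a then 1 else 0) + (if x = b then 1 else 0)

/-- Bookkeeping for `Represents`: removing an edge releases one stored value at each of its ends,
and two at the vertex of a loop. -/
theorem degree_extract {v u : ℕ} {w : ℝ} {E E' : List Edge}
    (h : extract v E = some ((u, w), E')) (x : ℕ) :
    degree E x = degree E' x + (if x = v then 1 else 0) + (if x = u then 1 else 0) := by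
  induction E generalizing E' with
  | nil => simp [extract] at h
  | cons e E ih =>
    obtain ⟨a, b, y⟩ := e
    simp only [extract] at h
    split_ifs at h with ha hb
    · simp only [Option.some.injEq, Prod.mk.injEq] at h
      obtain ⟨⟨rfl, rfl⟩, rfl⟩ := h
      rw [degree, ha]
    · simp only [Option.some.injEq, Prod.mk.injEq] at h
      obtain ⟨⟨rfl, rfl⟩, rfl⟩ := h
      rw [degree, hb]
      omega
    · simp only [Option.map_eq_some_iff, Prod.mk.injEq] at h
      obtain ⟨⟨r, F⟩, hF, h1, rfl⟩ := h
      obtain rfl : r = (u, w) := h1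
      simp only [degree]
      rw [ih hF]
      omega

/-- The lists `sigs` hold the first values, more than `d v` at the vertex `v`, of the vertex functions
`s`, and the cost of the numbers in the lists is bounded by `S`. -/
structure Represents (w : ℝ → ℕ) (P : ℝ → Prop) (S n : ℕ) (sigs : List (List ℝ)) (s : State)
    (d : ℕ → ℕ) : Prop where
  length : sigs.length = n
  value : ∀ v l, sigs[v]? = some l → ∀ i x, l[i]? = some x → s v i = x
  long : ∀ v l, sigs[v]? = some l → d v < l.length
  cost : ∀ l ∈ sigs, ∀ x ∈ l, P x ∧ w x ≤ S

section

variable {w : ℝ → ℕ} {P : ℝ → Prop} {β : ℚ} {S n : ℕ} {sigs : List (List ℝ)} {s : State}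
  {d d' : ℕ → ℕ} {c lam : ℝ}

theorem Represents.mono (h : Represents w P S n sigs s d) (hd : ∀ x, d' x ≤ d x) :
    Represents w P S n sigs s d' :=
  ⟨h.length, h.value, fun v l hl => (hd v).trans_lt (h.long v l hl), h.cost⟩

theorem Represents.tail (h : Represents w P S n sigs s d) (v : ℕ)
    (hd : ∀ x, d' x + (if x = v then 1 else 0) ≤ d x) :
    Represents w P S n (sigs.modify v List.tail) (shift v s) d' := by
  have key : ∀ x l, (sigs.modify v List.tail)[x]? = some l → ∃ l', sigs[x]? = some l' ∧
      (∀ i, l[i]? = l'[i + if x = v then 1 else 0]?) ∧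
      l.length + (if x = v then 1 else 0) ≥ l'.length := by
    intro x l hl
    rw [List.getElem?_modify] at hl
    cases hx : sigs[x]? with
    | none => simp [hx] at hl
    | some l' =>
      refine ⟨l', rfl, ?_⟩
      by_cases hxv : x = v
      · subst hxv
        simp [hx] at hl
        subst hl
        simp
        omega
      · simp [hx, Ne.symm hxv] at hl
        subst hl
        simp [hxv]
  refine ⟨by simp [h.length], ?_, ?_, ?_⟩
  · intro x l hl i y hy
    obtain ⟨l', hl', h1, -⟩ := key x l hl
    rw [h1] at hy
    exact h.value x l' hl' _ y hy
  · intro x l hl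
    obtain ⟨l', hl', -, h2⟩ := key x l hl
    have := h.long x l' hl'
    have := hd x
    omega
  · intro l hl y hy
    obtain ⟨x, hx⟩ := List.mem_iff_getElem?.1 hl
    obtain ⟨l', hl', h1, -⟩ := key x l hx
    obtain ⟨i, hi⟩ := List.mem_iff_getElem?.1 hy
    rw [h1] at hi
    exact h.cost l' (List.mem_of_getElem? hl') y (List.mem_of_getElem? hi)

theorem Represents.exists_cons_cons (h : Represents w P S n sigs s d) {v : ℕ} (hv : v < n)
    (hd : 1 ≤ d v) : ∃ t, sigs[v]? = some (s v 0 :: s v 1 :: t) := by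
  obtain ⟨l, hl⟩ : ∃ l, sigs[v]? = some l :=
    ⟨_, List.getElem?_eq_getElem (by rw [h.length]; exact hv)⟩
  have h1 := h.long v l hl
  have h2 := h.value v l hl
  match l, h1, h2, hl with
  | [], h1, _, _ => simp at h1
  | [_], h1, _, _ => simp at h1; omega
  | x :: y :: t, _, h2, hl => exact ⟨t, by rw [hl, h2 0 x rfl, h2 1 y rfl]⟩

theorem Represents.exists_cons (h : Represents w P S n sigs s d) {v : ℕ} {t : List ℝ}
    (hd : 2 ≤ d v) (hl : sigs[v]? = some (s v 0 :: s v 1 :: t)) : ∃ t', t = s v 2 :: t' := by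
  have h1 := h.long v _ hl
  have h2 := h.value v _ hl
  match t, h1, h2, hl with
  | [], h1, _, _ => simp at h1; omega
  | x :: t', _, h2, _ => exact ⟨t', by rw [h2 2 x rfl]⟩

/-- The edges are edges of a graph with `n` vertices, and their weights are at least `lam`; the cost
of the weights is at most `S`. -/
def GoodEdges (w : ℝ → ℕ) (P : ℝ → Prop) (S n : ℕ) (lam : ℝ) (E : List Edge) : Prop :=
  ∀ e ∈ E, e.1 < n ∧ e.2.1 < n ∧ lam ≤ e.2.2 ∧ P e.2.2 ∧ w e.2.2 ≤ S

/-- The argument of the function that computes marginals. -/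
noncomputable def ratioInput (l v : ℕ) (sigs : List (List ℝ)) (E : List Edge) : Val :=
  .cons (encodeFuel l) (.cons (.num v) (.cons (encodeSigs sigs) (encodeEdges E)))

/-- The extra unit at v in `hrep` pays for the dangling end whose marginal is computed. Each
recursive call uses at most what the removed edge releases. Three calls and boundedly many
operations per level multiply cost and bit length by constants, bounded generously by 1000 and 48.
-/
theorem costs_ratio (M : CostModel w P) (hc : 0 < c) (hlam : 0 < lam) (hn : n ≤ S) (l : ℕ) {v : ℕ}
    (hv : v < n) {E : List Edge} (hs : IsFib c s) (hE : GoodEdges w P S n lam E)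
    (hlen : E.length ≤ S)
    (hrep : Represents w P S n sigs s (fun x => degree E x + if x = v then 1 else 0)) :
    (P (ratio c l v s E) ∧ w (ratio c l v s E) ≤ 48 ^ (l + 1) * (S + 1)) ∧
    Costs w (functions β) [ratioInput l v sigs E] ratioTerm (.num (ratio c l v s E))
      (1000 ^ (l + 1) * (S + 1) ^ 2) := by
  induction l generalizing v sigs s E with
  | zero =>
    obtain ⟨t, ht⟩ := hrep.exists_cons_cons hv (by simp)
    have hmem := List.mem_of_getElem? ht
    obtain ⟨p0, w0⟩ := hrep.cost _ hmem (s v 0) (by simp)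
    obtain ⟨p1, w1⟩ := hrep.cost _ hmem (s v 1) (by simp)
    obtain ⟨p2, w2⟩ := M.div _ _ p1 p0
    have hget := costs_get (β := β) M ht
    refine ⟨⟨p2, ?_⟩, ?_⟩
    · simp only [ratio]
      omega
    · refine (Costs.split_cons (.var rfl) (.split_cons (.var rfl) (.split_cons (.var rfl)
        (.bind (.call rfl (.cons (.var rfl) (.var rfl)) hget)
          (.split_cons (.var rfl) (.split_cons (.var rfl) (.split_nil (.var rfl)
            (.div (.var rfl) (.var rfl) (hs.pos v).ne')))))))).mono ?_
      have h1 : (v + 1) ^ 2 ≤ (S + 1) ^ 2 := Nat.pow_le_pow_left (by omega) 2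
      have h2 : S + 1 ≤ (S + 1) ^ 2 := Nat.le_self_pow (by norm_num) _
      omega
  | succ l ih =>
    obtain ⟨t, ht⟩ := hrep.exists_cons_cons hv (by simp)
    have hmem := List.mem_of_getElem? ht
    obtain ⟨p0, w0⟩ := hrep.cost _ hmem (s v 0) (by simp)
    obtain ⟨p1, w1⟩ := hrep.cost _ hmem (s v 1) (by simp)
    have hget := costs_get (β := β) M ht
    have hext := costs_extract (β := β) M hv (E := E) fun e he => ⟨(hE e he).1, (hE e he).2.1⟩
    have hq1 : (v + 1) ^ 2 ≤ (S + 1) ^ 2 := Nat.pow_le_pow_left (by omega) 2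
    have hq2 : S + 1 ≤ (S + 1) ^ 2 := Nat.le_self_pow (by norm_num) _
    have hq3 : (E.length + 1) * (8 * n + 60) ≤ 60 * (S + 1) ^ 2 := by
      calc (E.length + 1) * (8 * n + 60) ≤ (S + 1) * (60 * (S + 1)) :=
            Nat.mul_le_mul (by omega) (by omega)
        _ = _ := by ring
    have hX : 1 ≤ 1000 ^ (l + 1) := Nat.one_le_pow _ _ (by norm_num)
    have hXq : (S + 1) ^ 2 ≤ 1000 ^ (l + 1) * (S + 1) ^ 2 := Nat.le_mul_of_pos_left _ hX
    have hY : 1 ≤ 48 ^ (l + 1) := Nat.one_le_pow _ _ (by norm_num)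
    have hYq : S + 1 ≤ 48 ^ (l + 1) * (S + 1) := Nat.le_mul_of_pos_left _ hY
    have hYX : 48 ^ (l + 1) * (S + 1) ≤ 1000 ^ (l + 1) * (S + 1) ^ 2 :=
      Nat.mul_le_mul (Nat.pow_le_pow_left (by norm_num) _) hq2
    have eX : 1000 ^ (l + 1 + 1) * (S + 1) ^ 2 = 1000 * (1000 ^ (l + 1) * (S + 1) ^ 2) := by ring
    have eY : 48 ^ (l + 1 + 1) * (S + 1) = 48 * (48 ^ (l + 1) * (S + 1)) := by ring
    rw [eX, eY]
    generalize 1000 ^ (l + 1) * (S + 1) ^ 2 = X at *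
    generalize 48 ^ (l + 1) * (S + 1) = Y at *
    cases hx : extract v E with
    | none =>
      rw [hx] at hext
      have hr : ratio c (l + 1) v s E = s v 1 / s v 0 := by rw [ratio, hx]
      obtain ⟨p2, w2⟩ := M.div _ _ p1 p0
      rw [hr]
      refine ⟨⟨p2, by omega⟩, ?_⟩
      refine (Costs.split_cons (.var rfl) (.split_cons (.var rfl) (.split_cons (.var rfl)
        (.bind (.call rfl (.cons (.var rfl) (.var rfl)) hget)
          (.split_cons (.var rfl) (.split_cons (.var rfl) (.split_cons (.var rfl)
            (.split_nil (.call rfl (.cons (.var rfl) (.var rfl)) hext)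
              (.div (.var rfl) (.var rfl) (hs.pos v).ne'))))))))).mono ?_
      omega
    | some r =>
      obtain ⟨⟨u, x⟩, E'⟩ := r
      rw [hx] at hext
      have hr : ratio c (l + 1) v s E = (ratio c l v s E' +
          x * ratio c l u s E' * (c * ratio c l v (shift u s) E' + 1)) /
          (1 + x * ratio c l u s E' * ratio c l v (shift u s) E') := by rw [ratio, hx]
      obtain ⟨hsub, hmemE⟩ := extract_sublist hx
      have hdeg := degree_extract hx
      have hE' : GoodEdges w P S n lam E' := fun e he => hE e (hsub.subset he)
      have hE'₀ : ∀ e ∈ E', lam ≤ e.2.2 := fun e he => (hE' e he).2.2.1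
      have hlen' : E'.length ≤ S := hsub.length_le.trans hlen
      obtain ⟨hu, hx0, px, wx⟩ : u < n ∧ lam ≤ x ∧ P x ∧ w x ≤ S := by
        rcases hmemE with h | h
        · exact (hE _ h).2
        · exact ⟨(hE _ h).1, (hE _ h).2.2⟩
      have hx0 : 0 < x := hlam.trans_le hx0
      have hs' := hs.shift hc u
      obtain ⟨⟨pA, wA⟩, hA⟩ := ih hv hs hE' hlen' (hrep.mono fun y => by have := hdeg y; omega)
      obtain ⟨⟨pB, wB⟩, hB⟩ := ih hu hs hE' hlen' (hrep.mono fun y => by have := hdeg y; omega)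
      obtain ⟨⟨pC, wC⟩, hC⟩ := ih hv hs' hE' hlen'
        (hrep.tail u fun y => by have := hdeg y; omega)
      have htail := costs_tail (β := β) M (hrep.length.symm ▸ hu)
      have hq4 : (u + 1) ^ 2 ≤ (S + 1) ^ 2 := Nat.pow_le_pow_left (by omega) 2
      -- An edge meets v, so with the dangling end at least three values f_0, f_1, f_2 are stored
      -- there.
      obtain ⟨t, rfl⟩ := hrep.exists_cons (by have := hdeg v; simp at this ⊢; omega) ht
      obtain ⟨p2, w2⟩ := hrep.cost _ hmem (s v 2) (by simp)
      have f1pos : 0 < s v 1 :=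
        (mul_pos (by positivity) (hs.pos v)).trans_le (hs.lower v)
      -- This is how the program obtains c.
      have hcv : (s v 2 - s v 0) / s v 1 = c := by
        have := hs.recurrence v 0
        simp only [zero_add] at this
        rw [this]
        field_simp
        ring
      have A0 := ratio_pos hc hlam l v hs hE'₀
      have B0 := ratio_pos hc hlam l u hs hE'₀
      have C0 := ratio_pos hc hlam l v hs' hE'₀
      rw [hr]
      generalize ratio c l v s E' = A at *
      generalize ratio c l u s E' = B at *
      generalize ratio c l v (shift u s) E' = C at *
      rw [← hcv]
      obtain ⟨q1, e1⟩ := M.one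
      obtain ⟨p3, w3⟩ := M.sub _ _ p2 p0
      obtain ⟨p4, w4⟩ := M.div _ _ p3 p1
      obtain ⟨p5, w5⟩ := M.mul _ _ p4 pC
      obtain ⟨p6, w6⟩ := M.add _ _ p5 q1
      obtain ⟨p7, w7⟩ := M.mul _ _ px pB
      obtain ⟨p8, w8⟩ := M.mul _ _ p7 p6
      obtain ⟨p9, w9⟩ := M.add _ _ pA p8
      obtain ⟨p10, w10⟩ := M.mul _ _ p7 pC
      obtain ⟨p11, w11⟩ := M.add _ _ q1 p10
      obtain ⟨p12, w12⟩ := M.div _ _ p9 p11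
      refine ⟨⟨p12, by omega⟩, ?_⟩
      refine (Costs.split_cons (.var rfl) (.split_cons (.var rfl) (.split_cons (.var rfl)
        (.bind (.call rfl (.cons (.var rfl) (.var rfl)) hget)
          (.split_cons (.var rfl) (.split_cons (.var rfl) (.split_cons (.var rfl)
            (.split_cons (.call rfl (.cons (.var rfl) (.var rfl)) hext)
              (.split_cons (.var rfl) (.split_cons (.var rfl)
                (.bind (.call rfl (.cons (.var rfl) (.cons (.var rfl)
                  (.cons (.var rfl) (.var rfl)))) hA)
                (.bind (.call rfl (.cons (.var rfl) (.cons (.var rfl)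
                  (.cons (.var rfl) (.var rfl)))) hB)
                (.bind (.call rfl (.cons (.var rfl) (.cons (.var rfl)
                  (.cons (.call rfl (.cons (.var rfl) (.var rfl)) htail) (.var rfl)))) hC)
                (.bind (.mul (.var rfl) (.var rfl))
                (.div (.add (.var rfl) (.mul (.var rfl) (.add (.mul (.div (.sub (.var rfl)
                  (.var rfl)) (.var rfl) f1pos.ne') (.var rfl)) .one)))
                  (.add .one (.mul (.var rfl) (.var rfl)))
                    (by positivity)))))))))))))))).mono ?_
      dsimp only
      omega

end

/-! ### Cost of the remaining functions and of the whole program -/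

section

variable {w : ℝ → ℕ} {P : ℝ → Prop} {β κ : ℚ} {S n : ℕ} {sigs : List (List ℝ)} {s : State}
  {c lam : ℝ}

theorem costs_count (M : CostModel w P) (E : List Edge) :
    Costs w (functions β) [encodeEdges E] countTerm (.num ((E.length + 1 : ℕ) : ℝ))
      (10 * (E.length + 1) ^ 2) := by
  have h1 := M.one
  induction E with
  | nil =>
    rw [List.length_nil, zero_add, Nat.cast_one]
    exact (Costs.split_nil (.var rfl) .one).mono (by norm_num)
  | cons e E ih =>
    have h2 := M.nat (E.length + 1)
    have h3 := M.nat (E.length + 1 + 1)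
    have h := Costs.add (w := w) (fs := functions β)
      (env := [encodeEdge e, encodeEdges E, encodeEdges (e :: E)]) (a := .const 1)
      (b := .call 5 (.var 1)) .one (.call rfl (.var rfl) ih)
    have e1 : (1 : ℝ) + ((E.length + 1 : ℕ) : ℝ) = ((E.length + 1 + 1 : ℕ) : ℝ) := by
      push_cast; ring
    rw [e1] at h
    rw [List.length_cons]
    refine (Costs.split_cons (.var rfl) h).mono ?_
    have : 10 * (E.length + 1 + 1) ^ 2 = 10 * (E.length + 1) ^ 2 + 20 * E.length + 30 := by ring
    omega

/-- The product of the first values of the vertex functions. -/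
noncomputable def headProduct (sigs : List (List ℝ)) : ℝ := (sigs.map fun l => l.headD 0).prod

theorem costs_heads (M : CostModel w P) {N : ℕ} (hN : sigs.length ≤ N)
    (hne : ∀ l ∈ sigs, l ≠ []) (hcost : ∀ l ∈ sigs, ∀ x ∈ l, P x ∧ w x ≤ S) :
    (P (headProduct sigs) ∧ w (headProduct sigs) ≤ sigs.length * S + 2) ∧
    Costs w (functions β) [encodeSigs sigs] headsTerm (.num (headProduct sigs))
      ((sigs.length + 1) * (2 * (N * S) + S + 40)) := by
  induction sigs with
  | nil =>
    refine ⟨by simpa [headProduct] using M.one, ?_⟩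
    simp only [headProduct, List.map_nil, List.prod_nil]
    exact (Costs.split_nil (.var rfl) .one).mono (by simp)
  | cons l sigs ih =>
    have hN' : sigs.length + 1 ≤ N := hN
    obtain ⟨⟨p, wp⟩, h⟩ := ih (by omega) (fun l hl => hne l (List.mem_cons_of_mem _ hl))
      (fun l hl => hcost l (List.mem_cons_of_mem _ hl))
    cases l with
    | nil => exact absurd rfl (hne [] List.mem_cons_self)
    | cons x l =>
      obtain ⟨px, wx⟩ := hcost (x :: l) List.mem_cons_self x List.mem_cons_self
      obtain ⟨pm, wm⟩ := M.mul _ _ px p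
      have e1 : headProduct ((x :: l) :: sigs) = x * headProduct sigs := by
        simp [headProduct]
      rw [e1]
      have e2 : (((x :: l) :: sigs).length) * S = sigs.length * S + S := by
        rw [List.length_cons]; ring
      have e3 : (((x :: l) :: sigs).length + 1) * (2 * (N * S) + S + 40) =
          (sigs.length + 1) * (2 * (N * S) + S + 40) + (2 * (N * S) + S + 40) := by
        rw [List.length_cons]; ring
      have e4 : sigs.length * S + S ≤ N * S := by
        calc _ = (sigs.length + 1) * S := by ring
          _ ≤ _ := Nat.mul_le_mul_right _ hN'
      rw [e2, e3]
      refine ⟨⟨pm, by omega⟩, ?_⟩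
      refine (Costs.split_cons (.var rfl) (.split_cons (.var rfl)
        (.mul (.var rfl) (.call rfl (.var rfl) h)))).mono ?_
      omega

theorem Represents.headProduct_eq {d : ℕ → ℕ} (h : Represents w P S n sigs s d) :
    headProduct sigs = ∏ x ∈ Finset.range n, s x 0 := by
  have : ∏ x ∈ Finset.range n, s x 0 = ((List.range n).map fun x => s x 0).prod := rfl
  rw [this, headProduct]
  congr 1
  refine List.ext_getElem (by simp [h.length]) fun i h1 h2 => ?_
  rw [List.length_map] at h1
  simp only [List.getElem_map, List.getElem_range]
  have hl := List.getElem?_eq_getElem h1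
  have hlong := h.long i _ hl
  have hval := h.value i _ hl 0
  cases hx : sigs[i] with
  | nil => simp [hx] at hlong
  | cons x l =>
    rw [hx] at hval
    exact (hval x rfl).symm

theorem Represents.ne_nil {d : ℕ → ℕ} (h : Represents w P S n sigs s d) :
    ∀ l ∈ sigs, l ≠ [] := by
  rintro l hl rfl
  obtain ⟨i, hi⟩ := List.mem_iff_getElem?.1 hl
  simpa using h.long i _ hi

/-- Each edge adds two marginals and one factor, so bit lengths add up along the product instead of
multiplying. -/
theorem costs_approx (M : CostModel w P) (hc : 0 < c) (hlam : 0 < lam) (hn : n ≤ S) (l : ℕ)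
    {E : List Edge} (hs : IsFib c s) (hE : GoodEdges w P S n lam E) (hlen : E.length ≤ S)
    (hrep : Represents w P S n sigs s (degree E)) :
    (P (approx n c l s E) ∧
      w (approx n c l s E) ≤ n * S + 2 + E.length * (2 * S + 4 * (48 ^ (l + 1) * (S + 1)) + 5)) ∧
    Costs w (functions β) [.cons (encodeFuel l) (.cons (encodeSigs sigs) (encodeEdges E))]
      approxTerm (.num (approx n c l s E))
      ((E.length + S + 1) * (300 * (1000 ^ (l + 1) * (S + 1) ^ 2))) := by
  have hq2 : S + 1 ≤ (S + 1) ^ 2 := Nat.le_self_pow (by norm_num) _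
  have hX : (S + 1) ^ 2 ≤ 1000 ^ (l + 1) * (S + 1) ^ 2 :=
    Nat.le_mul_of_pos_left _ (Nat.one_le_pow _ _ (by norm_num))
  have hYX : (S + 1) * (48 ^ (l + 1) * (S + 1)) ≤ 1000 ^ (l + 1) * (S + 1) ^ 2 := by
    calc _ = 48 ^ (l + 1) * (S + 1) ^ 2 := by ring
      _ ≤ _ := Nat.mul_le_mul_right _ (Nat.pow_le_pow_left (by norm_num) _)
  have hY : S + 1 ≤ 48 ^ (l + 1) * (S + 1) :=
    Nat.le_mul_of_pos_left _ (Nat.one_le_pow _ _ (by norm_num))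
  have hnS : n * S ≤ (S + 1) ^ 2 := by
    calc n * S ≤ (S + 1) * (S + 1) := Nat.mul_le_mul (by omega) (by omega)
      _ = _ := by ring
  have hratio := fun (v : ℕ) (hv : v < n) (E : List Edge) (sigs : List (List ℝ)) (s : State) =>
    costs_ratio (β := β) M hc hlam hn l hv (E := E) (sigs := sigs) (s := s)
  generalize 1000 ^ (l + 1) * (S + 1) ^ 2 = X at *
  generalize 48 ^ (l + 1) * (S + 1) = Y at *
  induction E with
  | nil =>
    obtain ⟨⟨p, wp⟩, h⟩ := costs_heads (β := β) M hrep.length.le hrep.ne_nil hrep.cost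
    rw [hrep.length] at wp h
    rw [approx, ← hrep.headProduct_eq]
    refine ⟨⟨p, by simpa using wp⟩, ?_⟩
    refine (Costs.split_cons (.var rfl) (.split_cons (.var rfl) (.split_nil (.var rfl)
      (.call rfl (.var rfl) h)))).mono ?_
    have h1 : (n + 1) * (2 * (n * S) + S + 40) ≤ (S + 1) * (43 * X) :=
      Nat.mul_le_mul (by omega) (by omega)
    have h2 : X ≤ (S + 1) * X := Nat.le_mul_of_pos_left _ (by omega)
    have h3 : (S + 1) * (43 * X) = 43 * ((S + 1) * X) := by ring
    have h4 : (([] : List Edge).length + S + 1) * (300 * X) = 300 * ((S + 1) * X) := by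
      rw [List.length_nil]; ring
    omega
  | cons e E ih =>
    obtain ⟨u, v, x⟩ := e
    obtain ⟨hu, hv, hx, px, wx⟩ := hE (u, v, x) List.mem_cons_self
    simp only at hu hv hx px wx
    have hE' : GoodEdges w P S n lam E := fun e he => hE e (List.mem_cons_of_mem _ he)
    have hlen1 : E.length + 1 ≤ S := hlen
    obtain ⟨⟨pa, wa⟩, ha⟩ := ih hE' (by omega)
      (hrep.mono fun y => by simp only [degree]; omega)
    obtain ⟨⟨pR, wR⟩, hR⟩ := hratio v hv E sigs s hs hE' (by omega)
      (hrep.mono fun y => by simp only [degree]; omega)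
    obtain ⟨⟨pQ, wQ⟩, hQ⟩ := hratio u hu E (sigs.modify v List.tail) (shift v s) (hs.shift hc v) hE'
      (by omega) (hrep.tail v fun y => by simp only [degree]; omega)
    have htail := costs_tail (β := β) M (hrep.length.symm ▸ hv)
    have hv2 : (v + 1) ^ 2 ≤ (S + 1) ^ 2 := Nat.pow_le_pow_left (by omega) 2
    rw [approx]
    generalize ratio c l v s E = R at *
    generalize ratio c l u (shift v s) E = Q at *
    generalize approx n c l s E = a at *
    obtain ⟨q1, e1⟩ := M.one
    obtain ⟨p1, w1⟩ := M.mul _ _ pR pQ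
    obtain ⟨p2, w2⟩ := M.mul _ _ px p1
    obtain ⟨p3, w3⟩ := M.add _ _ q1 p2
    obtain ⟨p4, w4⟩ := M.mul _ _ pa p3
    have h1 : ((u, v, x) :: E).length * (2 * S + 4 * Y + 5) =
        E.length * (2 * S + 4 * Y + 5) + (2 * S + 4 * Y + 5) := by
      rw [List.length_cons]; ring
    have h2 : (((u, v, x) :: E).length + S + 1) * (300 * X) =
        (E.length + S + 1) * (300 * X) + 300 * X := by
      rw [List.length_cons]; ring
    have h3 : E.length * (2 * S + 4 * Y + 5) + (2 * S + 4 * Y + 5) ≤ 11 * X := by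
      calc _ = (E.length + 1) * (2 * S + 4 * Y + 5) := by ring
        _ ≤ (S + 1) * (11 * Y) := Nat.mul_le_mul (by omega) (by omega)
        _ = 11 * ((S + 1) * Y) := by ring
        _ ≤ _ := by omega
    have h4 : Y ≤ X := (Nat.le_mul_of_pos_left _ (by omega)).trans hYX
    rw [h1, h2]
    refine ⟨⟨p4, by omega⟩, ?_⟩
    refine (Costs.split_cons (.var rfl) (.split_cons (.var rfl) (.split_cons (.var rfl)
      (.split_cons (.var rfl) (.split_cons (.var rfl)
        (.mul (.call rfl (.cons (.var rfl) (.cons (.var rfl) (.var rfl))) ha)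
          (.add .one (.mul (.var rfl) (.mul
            (.call rfl (.cons (.var rfl) (.cons (.var rfl) (.cons (.var rfl) (.var rfl)))) hR)
            (.call rfl (.cons (.var rfl) (.cons (.var rfl)
              (.cons (.call rfl (.cons (.var rfl) (.var rfl)) htail) (.var rfl)))) hQ)))))))))).mono ?_
    omega

/-- Repeated multiplication by β replaces a logarithm; each round adds at most the cost of β to that
of y. -/
theorem costs_fuel (M : CostModel w P) (hβ : w β ≤ S) {l D : ℕ} {y : ℝ} (hy : P y)
    (hlt : ∀ j < l, y * (β : ℝ) ^ j < 1) (hle : 1 ≤ y * (β : ℝ) ^ l) (hD : w y + l * S ≤ D) :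
    Costs w (functions β) [.num y] (fuelTerm β) (encodeFuel l) ((l + 1) * (4 * D + 20)) := by
  have h1 := M.one
  induction l generalizing y with
  | zero =>
    refine (Costs.ifLe_true .one (.var rfl) (by simpa using hle) .nil).mono ?_
    omega
  | succ l ih =>
    obtain ⟨pm, wm⟩ := M.mul _ _ hy (M.rat β)
    have e1 : (l + 1) * S = l * S + S := by ring
    have e2 : (l + 1 + 1) * (4 * D + 20) = (l + 1) * (4 * D + 20) + (4 * D + 20) := by ring
    have h := ih pm (fun j hj => by
        have := hlt (j + 1) (by omega)
        rwa [pow_succ', ← mul_assoc] at this)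
      (by rwa [pow_succ', ← mul_assoc] at hle) (by omega)
    have h0 : ¬ 1 ≤ y := by
      have := hlt 0 (by omega)
      rw [pow_zero, mul_one] at this
      exact not_le.2 this
    refine (Costs.ifLe_false .one (.var rfl) h0 (.cons .nil
      (.call rfl (.mul (.var rfl) (.const β)) h))).mono ?_
    omega

/-- The input of the program. -/
noncomputable def programInput (ε : ℝ) (sigs : List (List ℝ)) (E : List Edge) : Val :=
  .cons (.num ε) (.cons (encodeSigs sigs) (encodeEdges E))

theorem run_program_of_headProduct_nonpos (M : CostModel w P) {ε : ℝ} {E : List Edge}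
    (hn : sigs.length ≤ S) (hne : ∀ l ∈ sigs, l ≠ [])
    (hcost : ∀ l ∈ sigs, ∀ x ∈ l, P x ∧ w x ≤ S) (h : headProduct sigs ≤ 0) :
    ∃ t, (program β κ).Run w (programInput ε sigs E) (.num 0) t ∧ t ≤ 100 * (S + 1) ^ 3 := by
  obtain ⟨⟨p, wp⟩, hh⟩ := costs_heads (β := β) M hn hne hcost
  have h0 := M.zero
  refine (Costs.split_cons (.var rfl) (.split_cons (.var rfl)
    (.ifLe_true (.call rfl (.var rfl) hh) .zero h .zero))).mono ?_
  have h1 : sigs.length * S ≤ (S + 1) * (S + 1) := Nat.mul_le_mul (by omega) (by omega)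
  have h2 : (sigs.length + 1) * (2 * (S * S) + S + 40) ≤ (S + 1) * (43 * (S + 1) ^ 2) :=
    Nat.mul_le_mul (by omega) (by nlinarith)
  have h3 : (S + 1) * (43 * (S + 1) ^ 2) = 43 * (S + 1) ^ 3 := by ring
  have h4 : (S + 1) * (S + 1) ≤ (S + 1) ^ 3 := by
    calc _ = (S + 1) ^ 2 := by ring
      _ ≤ _ := Nat.pow_le_pow_right (by omega) (by norm_num)
  have h5 : 1 ≤ (S + 1) ^ 3 := Nat.one_le_pow _ _ (by omega)
  omega

theorem run_program (M : CostModel w P) (hc : 0 < c) (hlam : 0 < lam) (hn : n ≤ S) {l : ℕ}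
    {E : List Edge} (hs : IsFib c s) (hE : GoodEdges w P S n lam E) (hlen : E.length ≤ S)
    (hrep : Represents w P S n sigs s (degree E)) {ε : ℝ} (hε : 0 < ε) (pε : P ε) (wε : w ε ≤ S)
    (hβ : w β ≤ S) (hκ : w κ ≤ S)
    (hlt : ∀ j < l, κ * (ε / (1 + ε) / ((E.length + 1 : ℕ) : ℝ)) * (β : ℝ) ^ j < 1)
    (hle : 1 ≤ κ * (ε / (1 + ε) / ((E.length + 1 : ℕ) : ℝ)) * (β : ℝ) ^ l) :
    ∃ t, (program β κ).Run w (programInput ε sigs E) (.num (approx n c l s E)) t ∧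
      t ≤ 1000 ^ (l + 2) * (S + 1) ^ 3 := by
  obtain ⟨⟨p, wp⟩, hh⟩ := costs_heads (β := β) M hrep.length.le hrep.ne_nil hrep.cost
  have ha := (costs_approx (β := β) M hc hlam hn l hs hE hlen hrep).2
  have hcount := costs_count (β := β) M E
  obtain ⟨q0, e0⟩ := M.zero
  obtain ⟨q1, e1⟩ := M.one
  obtain ⟨p1, w1⟩ := M.add _ _ q1 pε
  obtain ⟨p2, w2⟩ := M.div _ _ pε p1
  obtain ⟨pm, wm⟩ := M.nat (E.length + 1)
  obtain ⟨p3, w3⟩ := M.div _ _ p2 pm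
  obtain ⟨p4, w4⟩ := M.mul _ _ (M.rat κ) p3
  -- The initial number costs at most 6S + 12, and each of the l rounds adds at most S.
  have hfuel := costs_fuel M hβ (D := (6 + l) * (S + 2)) p4 hlt hle (by
    have : (6 + l) * (S + 2) = 6 * S + 12 + l * S + 2 * l := by ring
    omega)
  have hpos : ¬ headProduct sigs ≤ 0 := by
    rw [hrep.headProduct_eq]
    exact not_le.2 (Finset.prod_pos fun x _ => hs.pos x)
  refine (Costs.split_cons (.var rfl) (.split_cons (.var rfl)
    (.ifLe_false (.call rfl (.var rfl) hh) .zero hpos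
      (.call rfl (.cons (.call rfl (.mul (.const κ) (.div (.div (.var rfl)
        (.add .one (.var rfl)) (by positivity)) (.call rfl (.var rfl) hcount)
          (by positivity))) hfuel) (.cons (.var rfl) (.var rfl))) ha)))).mono ?_
  rw [hrep.length] at wp ⊢
  have hq : (S + 1) ^ 2 ≤ (S + 1) ^ 3 := Nat.pow_le_pow_right (by omega) (by norm_num)
  have hq1 : S + 1 ≤ (S + 1) ^ 2 := Nat.le_self_pow (by norm_num) _
  have hX1 : 1 ≤ 1000 ^ (l + 1) := Nat.one_le_pow _ _ (by norm_num)
  have hX : (S + 1) ^ 3 ≤ 1000 ^ (l + 1) * (S + 1) ^ 3 := Nat.le_mul_of_pos_left _ hX1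
  have hl : (l + 1) * (l + 1) ≤ 1000 ^ (l + 1) := by
    calc (l + 1) * (l + 1) ≤ 2 ^ (l + 1) * 2 ^ (l + 1) :=
          Nat.mul_le_mul Nat.lt_two_pow_self.le Nat.lt_two_pow_self.le
      _ = 4 ^ (l + 1) := by rw [← mul_pow]; norm_num
      _ ≤ _ := Nat.pow_le_pow_left (by norm_num) _
  have h1 : (l + 1) * (4 * ((6 + l) * (S + 2)) + 20) ≤ 70 * (1000 ^ (l + 1) * (S + 1) ^ 3) := by
    calc (l + 1) * (4 * ((6 + l) * (S + 2)) + 20)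
        ≤ (l + 1) * (70 * ((l + 1) * (S + 1))) := Nat.mul_le_mul_left _ (by nlinarith)
      _ = 70 * ((l + 1) * (l + 1) * (S + 1)) := by ring
      _ ≤ 70 * (1000 ^ (l + 1) * (S + 1) ^ 3) :=
        Nat.mul_le_mul_left _ (Nat.mul_le_mul hl (by omega))
  have h2 : (E.length + S + 1) * (300 * (1000 ^ (l + 1) * (S + 1) ^ 2)) ≤
      600 * (1000 ^ (l + 1) * (S + 1) ^ 3) := by
    calc _ ≤ (2 * (S + 1)) * (300 * (1000 ^ (l + 1) * (S + 1) ^ 2)) :=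
          Nat.mul_le_mul_right _ (by omega)
      _ = _ := by ring
  have h3 : (n + 1) * (2 * (n * S) + S + 40) ≤ 43 * (S + 1) ^ 3 := by
    have : n * S ≤ S * S := Nat.mul_le_mul_right _ hn
    calc _ ≤ (S + 1) * (43 * (S + 1) ^ 2) := Nat.mul_le_mul (by omega) (by nlinarith)
      _ = _ := by ring
  have h4 : 10 * (E.length + 1) ^ 2 ≤ 10 * (S + 1) ^ 2 :=
    Nat.mul_le_mul_left _ (Nat.pow_le_pow_left (by omega) 2)
  have h5 : n * S ≤ (S + 1) ^ 2 := by
    calc n * S ≤ (S + 1) * (S + 1) := Nat.mul_le_mul (by omega) (by omega)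
      _ = _ := by ring
  have h6 : 1000 ^ (l + 2) * (S + 1) ^ 3 = 1000 * (1000 ^ (l + 1) * (S + 1) ^ 3) := by ring
  omega

end

/-! ### The two cost models -/

theorem costModel_unitCost : CostModel unitCost fun _ => True := by
  constructor <;> intros <;> simp [unitCost]

theorem bitLength_ratCast (q : ℚ) :
    bitLength q = Nat.size q.num.natAbs + Nat.size q.den := by
  have h : IsRat (q : ℝ) := ⟨q, rfl⟩
  have h' : h.choose = q := by exact_mod_cast h.choose_spec
  rw [bitLength, dif_pos h, h']

theorem size_mul_le (a b : ℕ) : Nat.size (a * b) ≤ Nat.size a + Nat.size b := by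
  rw [Nat.size_le, pow_add]
  exact mul_lt_mul'' (Nat.lt_size_self a) (Nat.lt_size_self b) (Nat.zero_le _) (Nat.zero_le _)

theorem size_add_le {a b k : ℕ} (ha : Nat.size a ≤ k) (hb : Nat.size b ≤ k) :
    Nat.size (a + b) ≤ k + 1 := by
  rw [Nat.size_le] at *
  rw [pow_succ]
  omega

/-- Passing to lowest terms replaces numerator and denominator by divisors. Hence unreduced
fractions bound the cost of field operations. -/
theorem bitLength_div_le (a b : ℤ) (hb : b ≠ 0) :
    bitLength (((a : ℚ) / b : ℚ) : ℝ) ≤ Nat.size a.natAbs + Nat.size b.natAbs := by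
  rw [bitLength_ratCast, ← Rat.divInt_eq_div]
  refine Nat.add_le_add (Nat.size_le_size ?_) (Nat.size_le_size ?_)
  · rcases eq_or_ne a 0 with rfl | ha
    · simp
    · exact Nat.le_of_dvd (Int.natAbs_pos.2 ha) (Int.natAbs_dvd_natAbs.2 (Rat.num_dvd a hb))
  · exact Nat.le_of_dvd (Int.natAbs_pos.2 hb) (Int.natCast_dvd.1 (Rat.den_dvd a b))

theorem bitLength_add_le (p q : ℚ) :
    bitLength ((p + q : ℚ) : ℝ) ≤ 2 * (bitLength p + bitLength q) + 1 := by
  have hp : (p.den : ℚ) ≠ 0 := by exact_mod_cast p.den_nz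
  have hq : (q.den : ℚ) ≠ 0 := by exact_mod_cast q.den_nz
  have h : p + q = ((p.num * q.den + q.num * p.den : ℤ) : ℚ) / ((p.den * q.den : ℤ) : ℚ) := by
    conv_lhs => rw [← Rat.num_div_den p, ← Rat.num_div_den q]
    push_cast
    field_simp
  have h1 := bitLength_div_le (p.num * q.den + q.num * p.den) (p.den * q.den)
    (by exact_mod_cast mul_ne_zero p.den_nz q.den_nz)
  rw [← h] at h1
  refine h1.trans ?_
  rw [bitLength_ratCast, bitLength_ratCast]
  have h2 := size_mul_le p.num.natAbs q.den
  have h3 := size_mul_le q.num.natAbs p.den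
  have h4 := size_mul_le p.den q.den
  have h5 : Nat.size (p.num * q.den + q.num * p.den).natAbs ≤
      (Nat.size p.num.natAbs + Nat.size p.den + (Nat.size q.num.natAbs + Nat.size q.den)) + 1 := by
    refine (Nat.size_le_size (Int.natAbs_add_le _ _)).trans (size_add_le ?_ ?_) <;>
      simp only [Int.natAbs_mul, Int.natAbs_natCast] <;> omega
  simp only [Int.natAbs_mul, Int.natAbs_natCast] at *
  omega

theorem bitLength_neg (q : ℚ) : bitLength ((-q : ℚ) : ℝ) = bitLength q := by
  rw [bitLength_ratCast, bitLength_ratCast]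
  simp

theorem bitLength_mul_le (p q : ℚ) :
    bitLength ((p * q : ℚ) : ℝ) ≤ bitLength p + bitLength q := by
  have h : p * q = ((p.num * q.num : ℤ) : ℚ) / ((p.den * q.den : ℤ) : ℚ) := by
    conv_lhs => rw [← Rat.num_div_den p, ← Rat.num_div_den q]
    push_cast
    rw [div_mul_div_comm]
  have h1 := bitLength_div_le (p.num * q.num) (p.den * q.den)
    (by exact_mod_cast mul_ne_zero p.den_nz q.den_nz)
  rw [← h] at h1
  refine h1.trans ?_
  rw [bitLength_ratCast, bitLength_ratCast]
  have h2 := size_mul_le p.num.natAbs q.num.natAbs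
  have h4 := size_mul_le p.den q.den
  simp only [Int.natAbs_mul, Int.natAbs_natCast] at *
  omega

theorem bitLength_inv_le (q : ℚ) : bitLength ((q⁻¹ : ℚ) : ℝ) ≤ bitLength q := by
  rcases eq_or_ne q 0 with rfl | hq
  · simp
  have h : q⁻¹ = ((q.den : ℤ) : ℚ) / (q.num : ℚ) := by
    conv_lhs => rw [← Rat.num_div_den q]
    rw [inv_div]
    push_cast
    rfl
  have h1 := bitLength_div_le q.den q.num (Rat.num_ne_zero.2 hq)
  rw [← h] at h1
  refine h1.trans ?_
  rw [bitLength_ratCast, Int.natAbs_natCast, add_comm]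

theorem costModel_bitLength : CostModel bitLength IsRat := by
  constructor
  · intro k
    refine ⟨⟨k, by simp⟩, ?_⟩
    have := bitLength_ratCast k
    rw [Rat.cast_natCast] at this
    rw [this]
    have : Nat.size k ≤ k := Nat.size_le.2 Nat.lt_two_pow_self
    simpa using this
  · exact fun q => ⟨q, rfl⟩
  · rintro _ _ ⟨p, rfl⟩ ⟨q, rfl⟩
    rw [← Rat.cast_add]
    exact ⟨⟨_, rfl⟩, bitLength_add_le p q⟩
  · rintro _ _ ⟨p, rfl⟩ ⟨q, rfl⟩
    rw [← Rat.cast_sub, sub_eq_add_neg, ← bitLength_neg q]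
    exact ⟨⟨_, rfl⟩, bitLength_add_le p (-q)⟩
  · rintro _ _ ⟨p, rfl⟩ ⟨q, rfl⟩
    rw [← Rat.cast_mul]
    exact ⟨⟨_, rfl⟩, bitLength_mul_le p q⟩
  · rintro _ _ ⟨p, rfl⟩ ⟨q, rfl⟩
    rw [← Rat.cast_div, div_eq_mul_inv]
    exact ⟨⟨_, rfl⟩, (bitLength_mul_le p q⁻¹).trans (Nat.add_le_add_left (bitLength_inv_le q) _)⟩

/-! ### Holant instances as states -/

/-- The edges of an instance. -/
noncomputable def edges (Ω : HolantInstance) : List Edge :=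
  List.ofFn fun e => (((Ω.ends e).1 : ℕ), ((Ω.ends e).2 : ℕ), Ω.weight e)

/-- The solution of the Fibonacci recurrence with given initial values. -/
def fibSeq (c a b : ℝ) : ℕ → ℝ
  | 0 => a
  | 1 => b
  | i + 2 => c * fibSeq c a b (i + 1) + fibSeq c a b i

/-- The continuation of a Fibonacci function to a sequence. -/
noncomputable def extend (c : ℝ) (f : List ℝ) : ℕ → ℝ :=
  -- A function of arity 0 has no second value; the default ratio c lies in [c/2, c + 2/c].
  fibSeq c (f.headD 0) (f.getD 1 (c * f.headD 0))

/-- The vertex functions of an instance. -/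
noncomputable def state (c : ℝ) (Ω : HolantInstance) : State := fun v =>
  -- Indices outside the graph also get ratio c, so that `IsFib` can be stated for all v.
  if h : v < Ω.n then extend c (Ω.sig ⟨v, h⟩) else fibSeq c 1 c

theorem extend_eq {c p q : ℝ} {f : List ℝ} (hf : f ∈ fibonacciFamily c p q) (i : ℕ)
    (hi : i < f.length) : extend c f i = f[i] := by
  induction i using Nat.strong_induction_on with
  | _ i ih =>
    match i, hi, ih with
    | 0, hi, _ =>
      cases f with
      | nil => simp at hi
      | cons x f => rfl
    | 1, hi, _ => simp [extend, fibSeq, hi]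
    | i + 2, hi, ih =>
      rw [hf.2.1 i hi, ← ih (i + 1) (by omega) (by omega), ← ih i (by omega) (by omega)]
      rfl

theorem isFib_state {c : ℝ} (hc : 0 < c) {Ω : HolantInstance}
    (hΩ : ∀ v, Ω.sig v ∈ fibonacciFamily c (c / 2) (c + 2 / c))
    (hpos : ∀ v, 0 < (Ω.sig v).headD 0) : IsFib c (state c Ω) := by
  have hc2 : 0 < 2 / c := by positivity
  constructor
  · intro v
    by_cases h : v < Ω.n
    · simpa [state, h, extend, fibSeq] using hpos ⟨v, h⟩
    · simp [state, h, fibSeq]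
  · intro v
    by_cases h : v < Ω.n
    · have hp := hpos ⟨v, h⟩
      have hf := hΩ ⟨v, h⟩
      simp only [state, h, dif_pos]
      by_cases hl : 1 < (Ω.sig ⟨v, h⟩).length
      · rw [extend_eq hf 0 (by omega), extend_eq hf 1 hl]
        exact (hf.2.2 0 hl).1
      · simp only [extend, fibSeq]
        rw [List.getD_eq_default _ _ (by omega)]
        nlinarith
    · simp only [state, h, dif_neg, not_false_eq_true, fibSeq]
      linarith
  · intro v
    by_cases h : v < Ω.n
    · have hp := hpos ⟨v, h⟩
      have hf := hΩ ⟨v, h⟩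
      simp only [state, h, dif_pos]
      by_cases hl : 1 < (Ω.sig ⟨v, h⟩).length
      · rw [extend_eq hf 0 (by omega), extend_eq hf 1 hl]
        exact (hf.2.2 0 hl).2
      · simp only [extend, fibSeq]
        rw [List.getD_eq_default _ _ (by omega)]
        nlinarith
    · simp only [state, h, dif_neg, not_false_eq_true, fibSeq]
      linarith
  · intro v i
    by_cases h : v < Ω.n <;> simp [state, h, extend, fibSeq]

theorem shift_shift_apply {n : ℕ} (p : Fin n × Fin n) (s : State) (v : Fin n) (i : ℕ) :
    shift p.1 (shift p.2 s) v i = s v (endsAt p v + i) := by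
  simp only [shift, endsAt, ← Fin.ext_iff, eq_comm (a := v)]
  congr 1
  omega

/-- Split the sum by the value on the first edge; choosing it shifts the function at both ends,
twice at a loop. -/
theorem sum_config_eq_partition {n m : ℕ} (ends : Fin m → Fin n × Fin n) (x : Fin m → ℝ)
    (s : State) :
    ∑ σ : Fin m → Bool, (∏ e, if σ e then x e else 1) *
      ∏ v : Fin n, s v (∑ e, if σ e then endsAt (ends e) v else 0) =
    partition n s (List.ofFn fun e => (((ends e).1 : ℕ), ((ends e).2 : ℕ), x e)) := by
  induction m generalizing s with
  | zero => simp [partition, Finset.prod_range]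
  | succ m ih =>
    rw [List.ofFn_succ, partition, ← ih, ← ih, ← (Fin.consEquiv fun _ => Bool).sum_comp,
      Fintype.sum_prod_type, Fintype.sum_bool, Finset.mul_sum, add_comm]
    congr 1
    · refine Finset.sum_congr rfl fun σ _ => ?_
      simp [Fin.prod_univ_succ, Fin.sum_univ_succ, Fin.consEquiv]
    · refine Finset.sum_congr rfl fun σ _ => ?_
      simp only [Fin.prod_univ_succ, Fin.sum_univ_succ, Fin.consEquiv, Equiv.coe_fn_mk,
        Fin.cons_zero, Fin.cons_succ, if_true, shift_shift_apply]
      ring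

theorem partition_state {c p q : ℝ} {Ω : HolantInstance}
    (hΩ : ∀ v, Ω.sig v ∈ fibonacciFamily c p q) :
    partition Ω.n (state c Ω) (edges Ω) = Ω.Z := by
  rw [edges, ← sum_config_eq_partition, HolantInstance.Z]
  refine Finset.sum_congr rfl fun σ _ => ?_
  rw [HolantInstance.configWeight]
  congr 1
  refine Finset.prod_congr rfl fun v _ => ?_
  rw [← extend_eq (hΩ v)]
  simp [state, HolantInstance.load]

theorem degree_ofFn {n m : ℕ} (ends : Fin m → Fin n × Fin n) (x : Fin m → ℝ) (v : Fin n) :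
    degree (List.ofFn fun e => (((ends e).1 : ℕ), ((ends e).2 : ℕ), x e)) v =
      ∑ e, endsAt (ends e) v := by
  induction m with
  | zero => simp [degree]
  | succ m ih =>
    rw [List.ofFn_succ, degree, Fin.sum_univ_succ, ih]
    simp only [endsAt, ← Fin.ext_iff, eq_comm (a := v)]
    omega

theorem represents_state {w : ℝ → ℕ} {P : ℝ → Prop} {S : ℕ} {c p q : ℝ} {Ω : HolantInstance}
    (hΩ : ∀ v, Ω.sig v ∈ fibonacciFamily c p q) (hcost : ∀ v, ∀ x ∈ Ω.sig v, P x ∧ w x ≤ S) :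
    Represents w P S Ω.n (List.ofFn Ω.sig) (state c Ω) (degree (edges Ω)) := by
  have key : ∀ v l, (List.ofFn Ω.sig)[v]? = some l → ∃ h : v < Ω.n, l = Ω.sig ⟨v, h⟩ := by
    intro v l hl
    obtain ⟨h, h'⟩ := List.getElem?_eq_some_iff.1 hl
    rw [List.length_ofFn] at h
    exact ⟨h, by rw [← h', List.getElem_ofFn]⟩
  refine ⟨by simp, ?_, ?_, ?_⟩
  · intro v l hl i x hx
    obtain ⟨h, rfl⟩ := key v l hl
    obtain ⟨hi, rfl⟩ := List.getElem?_eq_some_iff.1 hx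
    simp only [state, h, dif_pos]
    exact extend_eq (hΩ _) i hi
  · intro v l hl
    obtain ⟨h, rfl⟩ := key v l hl
    have := degree_ofFn Ω.ends Ω.weight ⟨v, h⟩
    dsimp only at this
    rw [Ω.sig_length, edges]
    omega
  · intro l hl x hx
    obtain ⟨v, rfl⟩ := (List.mem_ofFn' _ _).1 hl
    exact hcost v x hx

theorem encode_eq (Ω : HolantInstance) (ε : ℝ) :
    Ω.encode ε = programInput ε (List.ofFn Ω.sig) (edges Ω) := by
  simp only [HolantInstance.encode, programInput, encodeSigs, encodeEdges, edges, List.map_ofFn]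
  rfl

/-- The bound f_{i+1} ≤ q f_i and nonnegativity propagate f_0 = 0 to all values at v. -/
theorem Z_eq_zero {c p q : ℝ} {Ω : HolantInstance}
    (hΩ : ∀ v, Ω.sig v ∈ fibonacciFamily c p q) {v : Fin Ω.n} (hv : (Ω.sig v).headD 0 = 0) :
    Ω.Z = 0 := by
  have hf := hΩ v
  have hzero : ∀ (i : ℕ) (hi : i < (Ω.sig v).length), (Ω.sig v)[i] = 0 := by
    intro i
    induction i with
    | zero =>
      rw [← hv]
      generalize Ω.sig v = f
      intro hi
      cases f with
      | nil => simp at hi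
      | cons x f => rfl
    | succ i ih =>
      intro hi
      have h1 := (hf.2.2 i hi).2
      rw [ih (by omega), mul_zero] at h1
      exact le_antisymm h1 (hf.1 _ (List.getElem_mem hi))
  refine Finset.sum_eq_zero fun σ _ => ?_
  rw [HolantInstance.configWeight,
    Finset.prod_eq_zero (Finset.mem_univ v) (hzero _ (Ω.load_lt_length σ v)), mul_zero]

/-! ### The approximation scheme -/

/-- The least depth is taken: its predecessor fails, which bounds b^l from above and later makes the
cost polynomial. -/
theorem exists_depth {y b : ℝ} (hy : 0 < y) (hy' : y ≤ 1) (hb : 1 < b) :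
    ∃ l : ℕ, (∀ j < l, y * b ^ j < 1) ∧ 1 ≤ y * b ^ l ∧ b ^ l ≤ b / y := by
  classical
  have hex : ∃ l : ℕ, 1 ≤ y * b ^ l := by
    obtain ⟨l, hl⟩ := pow_unbounded_of_one_lt (1 / y) hb
    exact ⟨l, by rw [div_lt_iff₀ hy] at hl; linarith⟩
  have hlt : ∀ j < Nat.find hex, y * b ^ j < 1 := fun j hj => not_le.1 (Nat.find_min hex hj)
  refine ⟨Nat.find hex, hlt, Nat.find_spec hex, ?_⟩
  rw [le_div_iff₀ hy]
  rcases Nat.eq_zero_or_pos (Nat.find hex) with h | h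
  · rw [h, pow_zero]
    linarith
  · have h1 := hlt (Nat.find hex - 1) (by omega)
    obtain ⟨k, hk⟩ : ∃ k, Nat.find hex = k + 1 := ⟨Nat.find hex - 1, by omega⟩
    rw [hk, Nat.add_sub_cancel] at h1
    rw [hk, pow_succ]
    nlinarith

/-- From exp(-δ) ≥ 1 - δ > 1/(1 + ε) follows exp δ < 1 + ε, and 1/(1 + ε) > 1 - ε covers the other
side. -/
theorem approximatesWithin_of_near {ε δ Z z : ℝ} (hε : 0 < ε) (hZ : 0 < Z) (h : Near δ Z z)
    (hδ : δ < ε / (1 + ε)) : ApproximatesWithin ε Z z := by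
  have h1 : Real.exp δ < 1 + ε := by
    have h2 : 1 / (1 + ε) < Real.exp (-δ) := by
      have h3 := Real.add_one_le_exp (-δ)
      have h4 : 1 / (1 + ε) = 1 - ε / (1 + ε) := by field_simp; ring
      linarith
    rw [Real.exp_neg, ← one_div] at h2
    exact (one_div_lt_one_div (by positivity) (Real.exp_pos _)).1 h2
  refine ⟨fun _ => ⟨?_, ?_⟩, fun h0 => absurd h0 hZ.ne'⟩
  · by_contra! hz
    have hz0 : 0 < z := by
      have := h.1
      by_contra! hz'
      nlinarith [Real.exp_pos δ]
    have : Z < (1 + ε) * z := h.1.trans_lt (mul_lt_mul_of_pos_right h1 hz0)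
    nlinarith [mul_le_mul_of_nonneg_left hz (by linarith : (0 : ℝ) ≤ 1 + ε), mul_pos hε hε]
  · exact h.2.trans_lt (mul_lt_mul_of_pos_right h1 hZ)

/-- On every instance the program computes a good approximation, at a cost that is bounded in terms of
the depth of the recursion, for all cost models. -/
theorem exists_approximation {lam c : ℝ} (hlam : 0 < lam) (hc : 2.57 ≤ c) {β : ℚ} (hβ : 1 < β)
    (hβ' : (β : ℝ) ≤ (rate (lam * c ^ 2))⁻¹) {Ω : HolantInstance}
    (hΩ : Ω.IsInstanceOf (fibonacciFamily c (c / 2) (c + 2 / c)) (Set.Ici lam)) {ε : ℝ}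
    (hε : 0 < ε) :
    ∃ z, ApproximatesWithin ε Ω.Z z ∧ ∃ l : ℕ,
      (β : ℝ) ^ l ≤ 44 * β * ((Ω.m + 1) * (1 + 1 / ε)) ∧
      ∀ (w : ℝ → ℕ) (P : ℝ → Prop) (S : ℕ), CostModel w P → Ω.n ≤ S → Ω.m ≤ S → P ε → w ε ≤ S →
        w β ≤ S → w ((1 / 44 : ℚ) : ℝ) ≤ S → (∀ v, ∀ x ∈ Ω.sig v, P x ∧ w x ≤ S) →
        (∀ e, P (Ω.weight e) ∧ w (Ω.weight e) ≤ S) →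
        ∃ t, (program β (1 / 44)).Run w (Ω.encode ε) (.num z) t ∧
          t ≤ 1000 ^ (l + 2) * (S + 1) ^ 3 := by
  have hc0 : 0 < c := by linarith
  have hβr : (1 : ℝ) < β := by exact_mod_cast hβ
  have hlen : (edges Ω).length = Ω.m := List.length_ofFn
  have hsig : ∀ v, Ω.sig v ≠ [] := fun v h => by
    have := Ω.sig_length v
    simp [h] at this
  set y : ℝ := ((1 / 44 : ℚ) : ℝ) * (ε / (1 + ε) / ((Ω.m + 1 : ℕ) : ℝ)) with hy
  have hm : (1 : ℝ) ≤ ((Ω.m + 1 : ℕ) : ℝ) := by exact_mod_cast Nat.succ_pos _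
  have hy0 : 0 < y := by
    rw [hy]
    push_cast
    positivity
  have hyinv : (β : ℝ) / y = 44 * β * ((Ω.m + 1) * (1 + 1 / ε)) := by
    rw [hy]
    push_cast
    field_simp
    ring
  have hη : ε / (1 + ε) < 1 := by
    rw [div_lt_one (by positivity)]
    linarith
  have hη0 : 0 < ε / (1 + ε) := by positivity
  have hyη : y * (44 * ((Ω.m + 1 : ℕ) : ℝ)) = ε / (1 + ε) := by
    rw [hy]
    push_cast
    field_simp
  have hy1 : y ≤ 1 := by nlinarith
  rw [← hyinv]
  by_cases hpos : ∀ v, 0 < (Ω.sig v).headD 0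
  · obtain ⟨l, hlt, hle, hl⟩ := exists_depth hy0 hy1 hβr
    have hs := isFib_state hc0 hΩ.1 hpos
    have hEmem : ∀ e ∈ edges Ω, ∃ i, e = (((Ω.ends i).1 : ℕ), ((Ω.ends i).2 : ℕ), Ω.weight i) := by
      intro e he
      obtain ⟨i, rfl⟩ := (List.mem_ofFn' _ _).1 he
      exact ⟨i, rfl⟩
    have hE : ∀ e ∈ edges Ω, e.1 < Ω.n ∧ e.2.1 < Ω.n ∧ lam ≤ e.2.2 := by
      intro e he
      obtain ⟨i, rfl⟩ := hEmem e he
      exact ⟨Fin.is_lt _, Fin.is_lt _, hΩ.2 i⟩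
    refine ⟨approx Ω.n c l (state c Ω) (edges Ω), ?_, l, hl, ?_⟩
    · have hnear := near_partition_approx hc hlam l hs hE
      have hZ := partition_pos (n := Ω.n) hc0 hlam (fun e he => (hE e he).2.2) hs
      rw [partition_state hΩ.1] at hnear hZ
      refine approximatesWithin_of_near hε hZ hnear ?_
      have hr := rate_pos (k := lam * c ^ 2) (by positivity)
      have h1 : rate (lam * c ^ 2) ^ l ≤ y := by
        have h2 : (β : ℝ) ^ l ≤ ((rate (lam * c ^ 2)) ^ l)⁻¹ := by
          rw [← inv_pow]
          exact pow_le_pow_left₀ (by linarith) hβ' l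
        have h3 : 1 ≤ y * ((rate (lam * c ^ 2)) ^ l)⁻¹ :=
          hle.trans (mul_le_mul_of_nonneg_left h2 hy0.le)
        rw [← div_eq_mul_inv, le_div_iff₀ (by positivity), one_mul] at h3
        exact h3
      rw [hlen]
      -- Two marginals per edge with error 11 · rate^l each make 22; the program's 44 leaves room
      -- for strict inequality.
      have h4 : (Ω.m : ℝ) * (2 * (rate (lam * c ^ 2) ^ l * 11)) ≤ Ω.m * (22 * y) := by
        refine mul_le_mul_of_nonneg_left ?_ (Nat.cast_nonneg _)
        linarith
      rw [← hyη]
      push_cast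
      have : (0 : ℝ) ≤ Ω.m := Nat.cast_nonneg _
      nlinarith
    · intro w P S M hn hmS pε wε wβ wκ hcost hwt
      rw [encode_eq]
      have hgood : GoodEdges w P S Ω.n lam (edges Ω) := by
        intro e he
        obtain ⟨i, rfl⟩ := hEmem e he
        exact ⟨Fin.is_lt _, Fin.is_lt _, hΩ.2 i, hwt i⟩
      refine run_program M hc0 hlam hn hs hgood (hlen.trans_le hmS) (represents_state hΩ.1 hcost) hε
        pε wε wβ wκ ?_ ?_ <;> rw [hlen]
      · exact hlt
      · exact hle
  · push Not at hpos
    obtain ⟨v, hv⟩ := hpos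
    have hnonneg : ∀ v, 0 ≤ (Ω.sig v).headD 0 := fun v => by
      have h := (hΩ.1 v).1
      cases hf : Ω.sig v with
      | nil => simp
      | cons x f => exact h x (by simp [hf])
    have hv0 : (Ω.sig v).headD 0 = 0 := le_antisymm hv (hnonneg v)
    -- The program stops before any recursion, so depth 0 serves in the bounds.
    refine ⟨0, ⟨fun h => absurd (Z_eq_zero hΩ.1 hv0) h, fun _ => rfl⟩, 0, ?_, ?_⟩
    · rw [pow_zero, le_div_iff₀ hy0]
      linarith
    · intro w P S M hn hmS pε wε wβ wκ hcost hwt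
      rw [encode_eq]
      have hhead : headProduct (List.ofFn Ω.sig) = 0 := by
        rw [headProduct, List.map_ofFn, List.prod_ofFn]
        exact Finset.prod_eq_zero (Finset.mem_univ v) hv0
      obtain ⟨t, ht, htle⟩ := run_program_of_headProduct_nonpos (β := β) (κ := 1 / 44) (ε := ε)
        (E := edges Ω) M (S := S) (sigs := List.ofFn Ω.sig) (by simpa using hn)
        (fun l hl => by
          obtain ⟨v, rfl⟩ := (List.mem_ofFn' _ _).1 hl
          exact hsig v)
        (fun l hl => by
          obtain ⟨v, rfl⟩ := (List.mem_ofFn' _ _).1 hl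
          exact hcost v) hhead.le
      exact ⟨t, ht, htle.trans (Nat.mul_le_mul_right _ (by norm_num))⟩

/-- A cost bound in terms of the depth is a polynomial bound. -/
theorem depth_cost_le {b B K ε : ℝ} {k l m S t : ℕ} (hb : 1 < b) (hk : 1000 ≤ b ^ k) (hε : 0 < ε)
    (hl : b ^ l ≤ 44 * b * ((m + 1) * (1 + 1 / ε))) (hB : (m : ℝ) + 1 / ε + 1 ≤ B)
    (hS : (S : ℝ) + 1 ≤ K * B) (ht : t ≤ 1000 ^ (l + 2) * (S + 1) ^ 3) :
    (t : ℝ) ≤ (1000 ^ 2 * (44 * b) ^ k * K ^ 3) * B ^ (2 * k + 3) := by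
  have hm : (0 : ℝ) ≤ m := Nat.cast_nonneg _
  have hε' : 0 < 1 / ε := by positivity
  have h1 : ((m : ℝ) + 1) * (1 + 1 / ε) ≤ B * B :=
    mul_le_mul (by linarith) (by linarith) (by linarith) (by linarith)
  have h2 : (1000 : ℝ) ^ l ≤ (44 * b * (B * B)) ^ k := by
    -- The exponential cost 1000^l becomes a power of b^l, which is polynomial in m and 1/ε by the
    -- choice of depth.
    calc (1000 : ℝ) ^ l ≤ (b ^ k) ^ l := pow_le_pow_left₀ (by norm_num) hk l
      _ = (b ^ l) ^ k := by rw [← pow_mul, ← pow_mul, mul_comm]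
      _ ≤ _ := pow_le_pow_left₀ (by positivity)
        (hl.trans (mul_le_mul_of_nonneg_left h1 (by linarith))) k
  have h3 : ((S : ℝ) + 1) ^ 3 ≤ (K * B) ^ 3 := pow_le_pow_left₀ (by positivity) hS 3
  calc (t : ℝ) ≤ ((1000 ^ (l + 2) * (S + 1) ^ 3 : ℕ) : ℝ) := by exact_mod_cast ht
    _ = 1000 ^ 2 * (1000 ^ l * ((S : ℝ) + 1) ^ 3) := by push_cast; ring
    _ ≤ 1000 ^ 2 * ((44 * b * (B * B)) ^ k * (K * B) ^ 3) := by
      have h4 : 0 ≤ (44 * b * (B * B)) ^ k := (by positivity : (0 : ℝ) ≤ 1000 ^ l).trans h2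
      gcongr
    _ = _ := by rw [pow_add, pow_mul, mul_pow (44 * b)]; ring

theorem bitLength_sig_le (Ω : HolantInstance) (v : Fin Ω.n) {x : ℝ} (hx : x ∈ Ω.sig v) :
    bitLength x ≤ Ω.bitSize := by
  have h1 : bitLength x ≤ ((Ω.sig v).map bitLength).sum :=
    List.single_le_sum (by simp) _ (List.mem_map_of_mem hx)
  have h2 := Finset.single_le_sum (f := fun v => ((Ω.sig v).map bitLength).sum)
    (fun _ _ => Nat.zero_le _) (Finset.mem_univ v)
  unfold HolantInstance.bitSize
  omega

theorem bitLength_weight_le (Ω : HolantInstance) (e : Fin Ω.m) :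
    bitLength (Ω.weight e) ≤ Ω.bitSize := by
  have h2 := Finset.single_le_sum (f := fun e => bitLength (Ω.weight e))
    (fun _ _ => Nat.zero_le _) (Finset.mem_univ e)
  unfold HolantInstance.bitSize
  omega

end FibHolant

open FibHolant in
theorem theorem3 (lam c : ℝ) (hlam : 0 < lam) (hc : 2.57 ≤ c) :
    HasFPTAS (fibonacciFamily c (c / 2) (c + 2 / c)) (Set.Ici lam) := by
  have hk : 0 < lam * c ^ 2 := by
    have : 0 < c := by linarith
    positivity
  -- The rate is real and may be irrational; any rational β > 1 below its inverse gives a sufficient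
  -- depth, still logarithmic.
  obtain ⟨β, hβ1, hβ2⟩ := exists_rat_btwn (one_lt_inv_iff₀.2 ⟨rate_pos hk, rate_lt_one hk⟩)
  have hβ : 1 < β := by exact_mod_cast hβ1
  obtain ⟨k, hk⟩ := pow_unbounded_of_one_lt (1000 : ℝ) hβ1
  -- This absorbs the bit lengths of the program constants, so that C depends on λ and c alone.
  set K : ℕ := bitLength β + bitLength ((1 / 44 : ℚ) : ℝ) + 1 with hK
  obtain ⟨C, hC⟩ := exists_nat_ge ((1000 : ℝ) ^ 2 * (44 * β) ^ k * (K : ℝ) ^ 3)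
  have hK1 : (1 : ℝ) ≤ K := by exact_mod_cast Nat.le_add_left 1 _
  refine ⟨program β (1 / 44), C, 2 * k + 3, fun Ω hΩ ε hε => ?_⟩
  obtain ⟨z, hz, l, hl, hrun⟩ := exists_approximation hlam hc hβ hβ2.le hΩ hε
  have hε' : 0 < 1 / ε := by positivity
  have hnm : Ω.size = Ω.n + Ω.m := rfl
  have hn0 : (0 : ℝ) ≤ Ω.n := Nat.cast_nonneg _
  have hm0 : (0 : ℝ) ≤ Ω.m := Nat.cast_nonneg _
  refine ⟨z, hz, ?_, fun hrat hεrat => ?_⟩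
  · obtain ⟨t, ht, htle⟩ := hrun unitCost (fun _ => True) Ω.size costModel_unitCost (by omega)
      (by omega) trivial (Nat.zero_le _) (Nat.zero_le _) (Nat.zero_le _)
      (fun _ _ _ => ⟨trivial, Nat.zero_le _⟩) (fun _ => ⟨trivial, Nat.zero_le _⟩)
    refine ⟨t, ht, ?_⟩
    have hB : (0 : ℝ) ≤ (Ω.size : ℝ) + 1 / ε + 1 := by positivity
    refine (depth_cost_le (K := K) (B := Ω.size + 1 / ε + 1) hβ1 hk.le hε hl ?_ ?_ htle).trans
      (mul_le_mul_of_nonneg_right hC (by positivity))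
    · rw [hnm]
      push_cast
      linarith
    · nlinarith
  · have hbits : Ω.size ≤ Ω.bitSize := by
      unfold HolantInstance.bitSize
      omega
    obtain ⟨t, ht, htle⟩ := hrun bitLength IsRat (Ω.bitSize + bitLength ε +
      (bitLength β + bitLength ((1 / 44 : ℚ) : ℝ))) costModel_bitLength (by omega)
      (by omega) hεrat (by omega) (by omega) (by omega)
      (fun v x hx => ⟨hrat.1 v x hx, (bitLength_sig_le Ω v hx).trans (by omega)⟩)
      (fun e => ⟨hrat.2 e, (bitLength_weight_le Ω e).trans (by omega)⟩)
    refine ⟨t, ht, ?_⟩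
    have hb0 : (0 : ℝ) ≤ bitLength ε := Nat.cast_nonneg _
    have hs0 : ((Ω.n + Ω.m : ℕ) : ℝ) ≤ Ω.bitSize := by exact_mod_cast hbits
    push_cast at hs0
    refine (depth_cost_le (K := K) (B := Ω.bitSize + bitLength ε + 1 / ε + 1) hβ1 hk.le hε hl
      ?_ ?_ htle).trans (mul_le_mul_of_nonneg_right hC (by positivity))
    · linarith
    · have hKr : (K : ℝ) = bitLength β + bitLength ((1 / 44 : ℚ) : ℝ) + 1 := by
        rw [hK]
        push_cast
        ring
      rw [Nat.cast_add, Nat.cast_add, Nat.cast_add]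
      nlinarith
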